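/- Let $(\mathcal M,\mathfrak g)$ be a smooth, geodesically complete Riemannian manifold (finite-dimensional, without boundary), so that the exponential map $\mathrm{Exp}_x$ is defined on all of $T_x\mathcal M$ for every $x\in\mathcal M$. Norms and inner products of tangent vectors are those of $\mathfrak g$, $\nabla$ denotes the Riemannian gradient, and parallel transport is that of the Levi-Civita connection. A differentiable function $h:\mathcal M\to\mathbb R$ is called $L$-g-smooth if for every geodesic $\gamma$, with $x=\gamma(0)$, $y=\gamma(1)$ and $v=\dot\gamma(0)$ (so that $y=\mathrm{Exp}_x(v)$, i.e. $v=\mathrm{Exp}_x^{-1}(y)$ if geodesics are unique), $$\|\nabla h(x)-\Gamma_y^x\nabla h(y)\|\le L\|v\|,$$ where $\Gamma_y^x:T_y\mathcal M\to T_x\mathcal M$ is the parallel transport along $\gamma$. Let $f_1,\dots,f_n:\mathcal M\to\mathbb R$ be differentiable and $L$-g-smooth with $L>0$, let $f=\frac1n\sum_{i=1}^n f_i$, and let $f^*\in\mathbb R$ satisfy $f(x)\ge f^*$ for all $x\in\mathcal M$. Let $x^0\in\mathcal M$, $p\in(0,1]$, $B=n$, let $b$ be an integer with $1\le b<B$,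 and let $$0<\eta\le\frac{1}{L\left(1+\sqrt{\frac{1-p}{pb}}\right)}.$$ For an integer $m$ with $1\le m\le n$ let $\nabla f_m(x)=\frac1m\sum_{i\in S}\nabla f_i(x)$ be the minibatch gradient, where $S$ is a uniformly random $m$-element subset of $\{1,\dots,n\}$ (so $\nabla f_B=\nabla f$ for $B=n$). The R-PAGE method sets $g^0=\nabla f_B(x^0)$ and, for $k=0,1,2,\dots$, $x^{k+1}=\mathrm{Exp}_{x^k}(-\eta g^k)$ and $$g^{k+1}=\begin{cases}\nabla f_B(x^{k+1}) & \text{with probability } p,\\ \Gamma_{x^k}^{x^{k+1}}(g^k)+\nabla f_b(x^{k+1})-\Gamma_{x^k}^{x^{k+1}}\big(\nabla f_b(x^k)\big) & \text{otherwise,}\end{cases}$$ where $\Gamma_{x^k}^{x^{k+1}}$ is the parallel transport along the geodesic $t\mapsto\mathrm{Exp}_{x^k}(-t\eta g^k)$, $t\in[0,1]$, the same minibatch is used in both terms $\nabla f_b$, and all coins and minibatches are mutually independent. Let $K\ge1$ and let $\widehat x^K$ be chosen uniformly at random from $x^0,\dots,x^{K-1}$, independently of the coins and minibatches. Then $\|\nabla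 f(\widehat x^K)\|^2$ is integrable and $$\mathbb E\left[\|\nabla f(\widehat x^K)\|^2\right]\le\frac{2\,(f(x^0)-f^*)}{\eta K}.$$ -/

import Mathlib

open MeasureTheory ProbabilityTheory Bundle
open scoped Manifold ContDiff

noncomputable section

namespace RPage

/-! ### Geodesics and parallel transport on a Riemannian manifold

`M` is a manifold without boundary modelled on the finite-dimensional space `E`; the Riemannian
metric is Mathlib's inner product on the fibres of the tangent bundle. -/

section Geometry

variable {E : Type*} [NormedAddCommGroup E] [NormedSpace ℝ E]
  {M : Type*} [TopologicalSpace M] [ChartedSpace E M]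

/-- The velocity `γ'(t) ∈ T_{γ t} M` of a curve. -/
def velocity (E : Type*) [NormedAddCommGroup E] [NormedSpace ℝ E] {M : Type*}
    [TopologicalSpace M] [ChartedSpace E M] (γ : ℝ → M) (t : ℝ) :
    TangentSpace 𝓘(ℝ, E) (γ t) :=
  mfderiv 𝓘(ℝ, ℝ) 𝓘(ℝ, E) γ t (1 : ℝ)

/-- The components of a tangent vector `v ∈ T_x M` in the chart `chartAt E c`. -/
def chartComponents (c : M) {x : M} (v : TangentSpace 𝓘(ℝ, E) x) : E :=
  mfderiv 𝓘(ℝ, E) 𝓘(ℝ, E) (chartAt E c) x v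

section Metric

variable [RiemannianBundle (fun x : M ↦ TangentSpace 𝓘(ℝ, E) x)]

/-- The Riemannian metric read in the chart `chartAt E c`, at the coordinate point `u`:
the bilinear form with matrix `g_{ij}(u)`. -/
def chartMetric (c : M) (u a b : E) : ℝ :=
  inner ℝ (mfderiv 𝓘(ℝ, E) 𝓘(ℝ, E) (chartAt E c).symm u a :
      TangentSpace 𝓘(ℝ, E) ((chartAt E c).symm u))
    (mfderiv 𝓘(ℝ, E) 𝓘(ℝ, E) (chartAt E c).symm u b)

/-- The Christoffel symbols of the first kind of the Levi-Civita connection in the chart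
`chartAt E c`: `Γ(a, b; w) = (∂_a g(b, w) + ∂_b g(a, w) - ∂_w g(a, b)) / 2`. -/
def christoffel (c : M) (u a b w : E) : ℝ :=
  (fderiv ℝ (fun u' ↦ chartMetric c u' b w) u a
    + fderiv ℝ (fun u' ↦ chartMetric c u' a w) u b
    - fderiv ℝ (fun u' ↦ chartMetric c u' a b) u w) / 2

/-- The vector field `V` along the curve `γ` is parallel for the Levi-Civita connection. In every
chart around every point of the curve, the components of `V` satisfy
`dVᵏ/dt + Γᵏᵢⱼ γ'ⁱ Vʲ = 0`, written here with the index `k` lowered by the metric. -/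
def IsParallelAlong (γ : ℝ → M) (V : ∀ t, TangentSpace 𝓘(ℝ, E) (γ t)) : Prop :=
  ∀ (t : ℝ) (c : M), γ t ∈ (chartAt E c).source →
    ∃ V' : E, HasDerivAt (fun s ↦ chartComponents c (V s)) V' t ∧
      ∀ w : E, chartMetric c (chartAt E c (γ t)) V' w
        + christoffel c (chartAt E c (γ t)) (chartComponents c (velocity E γ t))
            (chartComponents c (V t)) w = 0

variable (E) in
/-- `γ : ℝ → M` is a geodesic: a smooth curve whose velocity is parallel along it. -/
def IsGeodesic (γ : ℝ → M) : Prop :=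
  ContMDiff 𝓘(ℝ, ℝ) 𝓘(ℝ, E) ∞ γ ∧ IsParallelAlong γ (velocity E γ)

/-- `γ` is a geodesic with `γ(0) = x` and `γ'(0) = v`. -/
def IsGeodesicFrom (γ : ℝ → M) (x : M) (v : TangentSpace 𝓘(ℝ, E) x) : Prop :=
  IsGeodesic E γ ∧ (⟨γ 0, velocity E γ 0⟩ : TangentBundle 𝓘(ℝ, E) M) = ⟨x, v⟩

variable (E M) in
/-- Every geodesic extends to all times, i.e. `Exp_x` is defined on all of `T_x M` for all `x`. -/
def GeodesicallyComplete : Prop :=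
  ∀ (x : M) (v : TangentSpace 𝓘(ℝ, E) x), ∃ γ : ℝ → M, IsGeodesicFrom γ x v

open Classical in
/-- The geodesic with initial point `x` and initial velocity `v`
(constant if there is none, which does not occur on a complete manifold). -/
def geodesicFrom (x : M) (v : TangentSpace 𝓘(ℝ, E) x) : ℝ → M :=
  if h : ∃ γ : ℝ → M, IsGeodesicFrom γ x v then h.choose else fun _ ↦ x

/-- The exponential map `Exp_x : T_x M → M`. -/
def riemExp (x : M) (v : TangentSpace 𝓘(ℝ, E) x) : M := geodesicFrom x v 1

open Classical in
/-- Parallel transport along `γ` from time `s` to time `t` of a tangent vector `v` at `γ s`: the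
value at `t` of the parallel field along `γ` whose value at `s` is `v`. -/
def parallelTransport (γ : ℝ → M) (s t : ℝ) (v : TangentBundle 𝓘(ℝ, E) M) :
    TangentSpace 𝓘(ℝ, E) (γ t) :=
  if h : ∃ V : ∀ r, TangentSpace 𝓘(ℝ, E) (γ r), IsParallelAlong γ V ∧
      (⟨γ s, V s⟩ : TangentBundle 𝓘(ℝ, E) M) = v
  then h.choose t else 0

/-- The parallel transport `T_x M → T_y M`, `y = Exp_x(v)`, along the geodesic
`t ↦ Exp_x(t v)`, `t ∈ [0, 1]`. -/
def expTransport (x : M) (v w : TangentSpace 𝓘(ℝ, E) x) :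
    TangentSpace 𝓘(ℝ, E) (riemExp x v) :=
  parallelTransport (geodesicFrom x v) 0 1 ⟨x, w⟩

section Gradient

variable [FiniteDimensional ℝ E]

instance (x : M) : FiniteDimensional ℝ (TangentSpace 𝓘(ℝ, E) x) :=
  inferInstanceAs (FiniteDimensional ℝ E)

instance (x : M) : CompleteSpace (TangentSpace 𝓘(ℝ, E) x) :=
  FiniteDimensional.complete ℝ _

variable (E) in
/-- The Riemannian gradient: `⟪∇f(x), v⟫ = df_x(v)` for all `v ∈ T_x M`. -/
def riemGrad (f : M → ℝ) (x : M) : TangentSpace 𝓘(ℝ, E) x :=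
  (InnerProductSpace.toDual ℝ (TangentSpace 𝓘(ℝ, E) x)).symm (mfderiv 𝓘(ℝ, E) 𝓘(ℝ, ℝ) f x)

variable (E) in
/-- `f` is differentiable and geodesically `L`-smooth: for every geodesic `γ`, with `x = γ(0)`,
`y = γ(1)` and `v = γ'(0)`, so that `Exp_x(v) = y`,
one has `‖∇f(x) - Γ_y^x ∇f(y)‖ ≤ L ‖v‖`, where `Γ_y^x` is the parallel transport along `γ`.
If geodesics between two points are unique then `v = Exp_x⁻¹(y)`. -/
def GSmooth (L : ℝ) (f : M → ℝ) : Prop :=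
  MDifferentiable 𝓘(ℝ, E) 𝓘(ℝ, ℝ) f ∧
    ∀ γ : ℝ → M, IsGeodesic E γ →
      ‖riemGrad E f (γ 0) - parallelTransport γ 1 0 ⟨γ 1, riemGrad E f (γ 1)⟩‖
        ≤ L * ‖velocity E γ 0‖

end Gradient

end Metric

end Geometry

/-! ### The random choices of the algorithm -/

/-- A minibatch of size `m`, drawn without replacement from `n` indices. -/
def Batch (n m : ℕ) : Type := {S : Finset (Fin n) // S.card = m}

instance (n m : ℕ) : MeasurableSpace (Batch n m) := ⊤

/-- What is drawn in one iteration: the coin (`true` means that a large minibatch is used), a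
large minibatch of size `B` and a small minibatch of size `b`. -/
abbrev Sample (n B b : ℕ) : Type := Bool × Batch n B × Batch n b

/-- The law of a coin that shows `true` with probability `p`. -/
def coinLaw (p : ℝ) : Measure Bool :=
  ENNReal.ofReal p • Measure.dirac true + ENNReal.ofReal (1 - p) • Measure.dirac false

/-- The law of one iteration's choices: coin and minibatches are independent, and the minibatches
are uniformly distributed. -/
def sampleLaw (n B b : ℕ) (p : ℝ) : Measure (Sample n B b) :=
  (coinLaw p).prod ((uniformOn (Set.univ : Set (Batch n B))).prod
    (uniformOn (Set.univ : Set (Batch n b))))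

/-- The randomness of `K` iterations: i.i.d. samples `ξ 0, ξ 1, …` and, independent of them, an
index `J` uniformly distributed on `{0, …, K - 1}`. -/
structure IsSampling {Ω : Type*} [MeasurableSpace Ω] (P : Measure Ω) {n B b K : ℕ} (p : ℝ)
    (ξ : ℕ → Ω → Sample n B b) (J : Ω → Fin K) : Prop where
  measurable_sample : ∀ k, Measurable (ξ k)
  law_sample : ∀ k, P.map (ξ k) = sampleLaw n B b p
  indep_samples : iIndepFun ξ P
  measurable_index : Measurable J
  law_index : P.map J = uniformOn Set.univ
  indep_index : IndepFun J (fun o k ↦ ξ k o) P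

/-! ### The algorithm -/

section Algorithm

/-- The finite-sum objective `f = (1/n) ∑ᵢ fᵢ`. -/
def objective {M : Type*} {n : ℕ} (f : Fin n → M → ℝ) (x : M) : ℝ :=
  (n : ℝ)⁻¹ * ∑ i, f i x

variable {E : Type*} [NormedAddCommGroup E] [NormedSpace ℝ E] [FiniteDimensional ℝ E]
  {M : Type*} [TopologicalSpace M] [ChartedSpace E M]
  [RiemannianBundle (fun x : M ↦ TangentSpace 𝓘(ℝ, E) x)]

variable (E) in
/-- The minibatch gradient `(1/m) ∑_{i ∈ S} ∇fᵢ(x)`, where `m` is the size of `S`. -/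
def batchGrad {n m : ℕ} (f : Fin n → M → ℝ) (S : Batch n m) (x : M) :
    TangentSpace 𝓘(ℝ, E) x :=
  (m : ℝ)⁻¹ • ∑ i ∈ S.1, riemGrad E (f i) x

/-- One iteration of R-PAGE, from `(xᵏ, gᵏ)` to `(xᵏ⁺¹, gᵏ⁺¹)`, with `xᵏ⁺¹ = Exp_{xᵏ}(-η gᵏ)`. -/
def rpageStep {n B b : ℕ} (f : Fin n → M → ℝ) (η : ℝ) (z : TangentBundle 𝓘(ℝ, E) M)
    (s : Sample n B b) : TangentBundle 𝓘(ℝ, E) M :=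
  let x : M := z.1
  let g : TangentSpace 𝓘(ℝ, E) x := z.2
  let v : TangentSpace 𝓘(ℝ, E) x := -(η • g)
  ⟨riemExp x v,
    if s.1 = true then batchGrad E f s.2.1 (riemExp x v)
    else expTransport x v g + batchGrad E f s.2.2 (riemExp x v)
      - expTransport x v (batchGrad E f s.2.2 x)⟩

variable (E) in
/-- The sequence `(xᵏ, gᵏ)` of R-PAGE for given outcomes `s` of the random choices;
`s 0` is used for `g⁰` and `s (k + 1)` for `gᵏ⁺¹`. -/
def rpage {n B b : ℕ} (f : Fin n → M → ℝ) (η : ℝ) (x₀ : M) (s : ℕ → Sample n B b) :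
    ℕ → TangentBundle 𝓘(ℝ, E) M
  | 0 => ⟨x₀, batchGrad E f (s 0).2.1 x₀⟩
  | k + 1 => rpageStep f η (rpage f η x₀ s k) (s (k + 1))

end Algorithm

end RPage

end

open RPage

open scoped NNReal Topology

set_option maxSynthPendingDepth 3

/-! The Lyapunov function is `Φ(x, g) = f(x) - f* + η / (2 p) * ‖g - ∇f(x)‖ ^ 2`. In one step of the
algorithm the descent inequality along the geodesic `t ↦ Exp_x(-t η g)` bounds the decrease of `f`;
the error `g - ∇f(x)` is reset to zero with probability `p` and otherwise transported, with an added
centred error whose second moment is at most `(L η ‖g‖) ^ 2 / b`, as the minibatch is drawn without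
replacement from vectors of norm at most `L η ‖g‖`. The bound on the step size makes these terms add
up to `E[Φ(x', g')] ≤ Φ(x, g) - η / 2 * ‖∇f(x)‖ ^ 2`, and the sum over the iterations telescopes.

This requires parallel transport to be a linear isometry. In a chart it solves a linear ordinary
differential equation, so that around every time there is an interval on which it exists from every
initial time; as the line is connected, it exists for all times. A metric connection keeps inner
products of parallel fields constant, which gives uniqueness and the isometry property at once.
-/

namespace RPage

section LinearODE

variable {E : Type*} [NormedAddCommGroup E] [NormedSpace ℝ E] [CompleteSpace E] {A : ℝ → E →L[ℝ] E}

theorem exists_hasDerivAt_clm_of_norm_le {a b : ℝ} {D : ℝ≥0} (hA : ContinuousOn A (Set.Icc a b))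
    (hD : ∀ t ∈ Set.Icc a b, ‖A t‖ ≤ D) (hab : 2 * D * (b - a) ≤ 1) {s : ℝ}
    (hs : s ∈ Set.Icc a b) (v : E) :
    ∃ y : ℝ → E, y s = v ∧ ∀ t ∈ Set.Ioo a b, HasDerivAt y (A t (y t)) t := by
  have hPL : IsPicardLindelof (fun t x ↦ A t x) (⟨s, hs⟩ : Set.Icc a b) v ‖v‖₊ 0
      (2 * D * ‖v‖₊) D := by
    refine ⟨fun t ht ↦ ((A t).lipschitz.weaken (hD t ht)).lipschitzOnWith,
      fun x _ ↦ hA.clm_apply continuousOn_const, fun t ht x hx ↦ ?_, ?_⟩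
    · have hx' : ‖x‖ ≤ 2 * ‖v‖ := by
        have := norm_le_norm_add_norm_sub' x v
        rw [mem_closedBall_iff_norm, coe_nnnorm] at hx
        linarith
      calc ‖A t x‖ ≤ D * (2 * ‖v‖) := (A t).le_of_opNorm_le_of_le (hD t ht) hx'
        _ = (2 * D * ‖v‖₊ : ℝ≥0) := by push_cast; ring
    · have hmax : max (b - s) (s - a) ≤ b - a := max_le (by linarith [hs.1]) (by linarith [hs.2])
      calc ((2 * D * ‖v‖₊ : ℝ≥0) : ℝ) * max (b - s) (s - a)
          ≤ (2 * D * ‖v‖₊ : ℝ≥0) * (b - a) := by gcongr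
        _ = 2 * D * (b - a) * ‖v‖ := by push_cast; ring
        _ ≤ (‖v‖₊ : ℝ) - (0 : ℝ≥0) := by simpa using mul_le_of_le_one_left (norm_nonneg v) hab
  obtain ⟨y, hys, hy⟩ := hPL.exists_eq_forall_mem_Icc_hasDerivWithinAt₀
  exact ⟨y, hys, fun t ht ↦ (hy t (Set.Ioo_subset_Icc_self ht)).hasDerivAt (Icc_mem_nhds ht.1 ht.2)⟩

theorem exists_ball_forall_exists_hasDerivAt_clm {t₀ : ℝ} (hA : ∀ᶠ t in 𝓝 t₀, ContinuousAt A t) :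
    ∃ ε > 0, ∀ s ∈ Metric.ball t₀ ε, ∀ v : E, ∃ y : ℝ → E, y s = v ∧
      ∀ t ∈ Metric.ball t₀ ε, HasDerivAt y (A t (y t)) t := by
  set D : ℝ≥0 := ‖A t₀‖₊ + 1
  have hD : ∀ᶠ t in 𝓝 t₀, ‖A t‖ ≤ D :=
    (hA.self_of_nhds.norm.eventually_lt_const (by simp [D])).mono fun _ ↦ le_of_lt
  obtain ⟨δ, hδ, hball⟩ := Metric.nhds_basis_closedBall.eventually_iff.1 (hA.and hD)
  set ε := min δ (1 / (4 * D))
  have hεD : 2 * D * (t₀ + ε - (t₀ - ε)) ≤ 1 := by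
    have : ε * (4 * D) ≤ 1 := (le_div_iff₀ (by positivity)).1 (min_le_right _ _)
    linarith
  have hε : ∀ t ∈ Set.Icc (t₀ - ε) (t₀ + ε), ContinuousAt A t ∧ ‖A t‖ ≤ D := fun t ht ↦
    hball (Metric.closedBall_subset_closedBall (min_le_left _ _) (Real.closedBall_eq_Icc ▸ ht))
  refine ⟨ε, by positivity, fun s hs v ↦ ?_⟩
  rw [Real.ball_eq_Ioo] at hs ⊢
  exact exists_hasDerivAt_clm_of_norm_le (fun t ht ↦ (hε t ht).1.continuousWithinAt)
    (fun t ht ↦ (hε t ht).2) hεD (Set.Ioo_subset_Icc_self hs) v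

end LinearODE

section GlobalSections

variable {X : ℝ → Type*} {P : (∀ t, X t) → ℝ → Prop}

/-- The condition `P V t` on sections `V` of the family `X` behaves like a linear differential
equation: it is local in `t`, a solution on an interval is determined by its value at one time, and
near every time there are solutions with arbitrary initial data on an interval which does not
depend on these data. Stated abstractly because solutions along a curve in a manifold are known
only chart by chart. -/
structure IsUniquelySolvable (P : (∀ t, X t) → ℝ → Prop) : Prop where
  congr : ∀ {V W : ∀ t, X t} {t : ℝ}, P V t → (∀ᶠ s in 𝓝 t, W s = V s) → P W t
  eqOn : ∀ {I : Set ℝ} {V W : ∀ t, X t} {s : ℝ}, IsOpen I → IsPreconnected I →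
    (∀ t ∈ I, P V t) → (∀ t ∈ I, P W t) → s ∈ I → V s = W s → ∀ t ∈ I, V t = W t
  exists_near : ∀ t₀, ∃ ε > 0, ∀ s ∈ Metric.ball t₀ ε, ∀ v : X s, ∃ V : ∀ t, X t,
    V s = v ∧ ∀ t ∈ Metric.ball t₀ ε, P V t

namespace IsUniquelySolvable

theorem exists_union (hP : IsUniquelySolvable P) {I J : Set ℝ} {V W : ∀ t, X t} {s : ℝ}
    (hI : IsOpen I) (hI' : IsPreconnected I) (hJ : IsOpen J) (hJ' : IsPreconnected J)
    (hV : ∀ t ∈ I, P V t) (hW : ∀ t ∈ J, P W t) (hsI : s ∈ I) (hsJ : s ∈ J) (hs : V s = W s) :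
    ∃ U : ∀ t, X t, (∀ t ∈ I, U t = V t) ∧ ∀ t ∈ I ∪ J, P U t := by
  classical
  have hIJ : IsPreconnected (I ∩ J) := (hI'.ordConnected.inter hJ'.ordConnected).isPreconnected
  have hVW : ∀ t ∈ I ∩ J, V t = W t :=
    hP.eqOn (hI.inter hJ) hIJ (fun t ht ↦ hV t ht.1) (fun t ht ↦ hW t ht.2) ⟨hsI, hsJ⟩ hs
  let U : ∀ t, X t := fun t ↦ if t ∈ I then V t else W t
  have hUV : ∀ t ∈ I, U t = V t := fun t ht ↦ if_pos ht
  have hUW : ∀ t ∈ J, U t = W t := fun t ht ↦ by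
    by_cases htI : t ∈ I
    · exact (hUV t htI).trans (hVW t ⟨htI, ht⟩)
    · exact if_neg htI
  refine ⟨U, hUV, ?_⟩
  rintro t (ht | ht)
  · exact hP.congr (hV t ht) (Filter.eventually_of_mem (hI.mem_nhds ht) hUV)
  · exact hP.congr (hW t ht) (Filter.eventually_of_mem (hJ.mem_nhds ht) hUW)

/-- The times `t` which some solution on an open interval around `o` and `t`, with value `v` at
time `o`, reaches. -/
def reachable (P : (∀ t, X t) → ℝ → Prop) (o : ℝ) (v : X o) : Set ℝ :=
  {t | ∃ I : Set ℝ, IsOpen I ∧ IsPreconnected I ∧ o ∈ I ∧ t ∈ I ∧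
    ∃ V : ∀ t, X t, V o = v ∧ ∀ t ∈ I, P V t}

theorem ball_subset_reachable (hP : IsUniquelySolvable P) {o : ℝ} (v : X o) (t₀ : ℝ) :
    ∃ ε > 0, (Metric.ball t₀ ε ∩ reachable P o v).Nonempty →
      Metric.ball t₀ ε ⊆ reachable P o v := by
  obtain ⟨ε, hε, hloc⟩ := hP.exists_near t₀
  refine ⟨ε, hε, ?_⟩
  rintro ⟨s, hsJ, I, hI, hI', hoI, hsI, V, hVo, hV⟩ t ht
  obtain ⟨W, hWs, hW⟩ := hloc s hsJ (V s)
  have hJ : IsPreconnected (Metric.ball t₀ ε) := (convex_ball t₀ ε).isPreconnected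
  obtain ⟨U, hUV, hU⟩ :=
    hP.exists_union hI hI' Metric.isOpen_ball hJ hV hW hsI hsJ hWs.symm
  exact ⟨I ∪ Metric.ball t₀ ε, hI.union Metric.isOpen_ball, hI'.union s hsI hsJ hJ, .inl hoI,
    .inr ht, U, (hUV o hoI).trans hVo, hU⟩

theorem reachable_eq_univ (hP : IsUniquelySolvable P) {o : ℝ} (v : X o) :
    reachable P o v = Set.univ := by
  have hclopen : IsClopen (reachable P o v) := by
    refine ⟨⟨isOpen_iff_mem_nhds.2 fun t₀ ht₀ ↦ ?_⟩, isOpen_iff_mem_nhds.2 fun t₀ ht₀ ↦ ?_⟩ <;>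
      obtain ⟨ε, hε, hball⟩ := hP.ball_subset_reachable v t₀
    · filter_upwards [Metric.ball_mem_nhds t₀ hε] with t ht htR
      exact ht₀ (hball ⟨t, ht, htR⟩ (Metric.mem_ball_self hε))
    · exact Filter.mem_of_superset (Metric.ball_mem_nhds t₀ hε)
        (hball ⟨t₀, Metric.mem_ball_self hε, ht₀⟩)
  refine hclopen.eq_univ ⟨o, ?_⟩
  obtain ⟨ε, hε, hloc⟩ := hP.exists_near o
  have ho : o ∈ Metric.ball o ε := Metric.mem_ball_self hε
  exact ⟨_, Metric.isOpen_ball, (convex_ball o ε).isPreconnected, ho, ho, hloc o ho v⟩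

theorem exists_forall (hP : IsUniquelySolvable P) (o : ℝ) (v : X o) :
    ∃ V : ∀ t, X t, V o = v ∧ ∀ t, P V t := by
  have hreach : ∀ t, t ∈ reachable P o v := fun t ↦ hP.reachable_eq_univ v ▸ Set.mem_univ t
  choose I hI hI' hoI htI V hVo hV using hreach
  refine ⟨fun t ↦ V t t, hVo o, fun t ↦ hP.congr (hV t t (htI t)) ?_⟩
  filter_upwards [(hI t).mem_nhds (htI t)] with r hr
  have hcap : IsPreconnected (I r ∩ I t) :=
    ((hI' r).ordConnected.inter (hI' t).ordConnected).isPreconnected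
  exact hP.eqOn ((hI r).inter (hI t)) hcap (fun q hq ↦ hV r q hq.1) (fun q hq ↦ hV t q hq.2)
    ⟨hoI r, hoI t⟩ ((hVo r).trans (hVo t).symm) r ⟨htI r, hr⟩

end IsUniquelySolvable

end GlobalSections

section Coordinates

variable {E F : Type*} [NormedAddCommGroup E] [NormedSpace ℝ E]
  [NormedAddCommGroup F] [NormedSpace ℝ F]

theorem fderiv_bilinear_apply {B : E → F →L[ℝ] F →L[ℝ] ℝ} {p q : E → F} {u : E}
    (hB : DifferentiableAt ℝ B u) (hp : DifferentiableAt ℝ p u) (hq : DifferentiableAt ℝ q u)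
    (a : E) :
    fderiv ℝ (fun z ↦ B z (p z) (q z)) u a =
      fderiv ℝ B u a (p u) (q u) + B u (fderiv ℝ p u a) (q u) + B u (p u) (fderiv ℝ q u a) := by
  have hBp : DifferentiableAt ℝ (fun z ↦ B z (p z)) u := hB.clm_apply hp
  rw [fderiv_clm_apply hBp hq, fderiv_clm_apply hB hp]
  simp only [add_apply, ContinuousLinearMap.comp_apply, ContinuousLinearMap.flip_apply]
  ring

theorem fderiv_bilinear_apply_const {G : E → E →L[ℝ] E →L[ℝ] ℝ} {u : E}
    (hG : DifferentiableAt ℝ G u) (a b w : E) :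
    fderiv ℝ (fun z ↦ G z b w) u a = fderiv ℝ G u a b w := by
  simpa using fderiv_bilinear_apply hG (differentiableAt_const b) (differentiableAt_const w) a

theorem fderiv_bilinear_symm {G : E → E →L[ℝ] E →L[ℝ] ℝ} {u : E}
    (hG : DifferentiableAt ℝ G u) (hsymm : ∀ z a b, G z a b = G z b a) (a b w : E) :
    fderiv ℝ G u a b w = fderiv ℝ G u a w b := by
  simp only [← fderiv_bilinear_apply_const hG, hsymm _ b w]

/-- The Christoffel symbols of the first kind `(∂_a g(b, w) + ∂_b g(a, w) - ∂_w g(a, b)) / 2`, as a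
function of the first derivative `D` of the metric `g` and a bilinear form in `b` and `w`. -/
noncomputable def leviCivita (D : E →L[ℝ] E →L[ℝ] E →L[ℝ] ℝ) (a : E) : E →L[ℝ] E →L[ℝ] ℝ :=
  (1 / 2 : ℝ) • (D a + D.flip a - (D.flip a).flip)

theorem leviCivita_apply (D : E →L[ℝ] E →L[ℝ] E →L[ℝ] ℝ) (a b w : E) :
    leviCivita D a b w = (D a b w + D b a w - D w a b) / 2 := by
  simp only [leviCivita, smul_apply, add_apply, sub_apply, ContinuousLinearMap.flip_apply,
    smul_eq_mul]
  ring

theorem leviCivita_smul_left (D : E →L[ℝ] E →L[ℝ] E →L[ℝ] ℝ) (r : ℝ) (a : E) :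
    leviCivita D (r • a) = r • leviCivita D a := by
  ext b w
  simp only [leviCivita_apply, map_smul, smul_apply, smul_eq_mul]
  ring

theorem leviCivita_add_swap {D : E →L[ℝ] E →L[ℝ] E →L[ℝ] ℝ} (hD : ∀ a b w, D a b w = D a w b)
    (a b w : E) : leviCivita D a b w + leviCivita D a w b = D a b w := by
  rw [leviCivita_apply, leviCivita_apply, hD a w b, hD b a w, hD w a b]
  ring

theorem continuousAt_leviCivita {T : Type*} [TopologicalSpace T]
    {D : T → E →L[ℝ] E →L[ℝ] E →L[ℝ] ℝ} {a : T → E} {t : T} (hD : ContinuousAt D t)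
    (ha : ContinuousAt a t) : ContinuousAt (fun s ↦ leviCivita (D s) (a s)) t := by
  have hflip : ContinuousAt (fun s ↦ (D s).flip (a s)) t :=
    ((ContinuousLinearMap.flipₗᵢ ℝ E E (E →L[ℝ] ℝ)).continuous.continuousAt.comp hD).clm_apply ha
  have hflip' : ContinuousAt (fun s ↦ ((D s).flip (a s)).flip) t :=
    (ContinuousLinearMap.flipₗᵢ ℝ E E ℝ).continuous.continuousAt.comp hflip
  exact (((hD.clm_apply ha).add hflip).sub hflip').const_smul (1 / 2 : ℝ)

variable {G : E → E →L[ℝ] E →L[ℝ] ℝ} {G' : F → F →L[ℝ] F →L[ℝ] ℝ} {φ : E → F} {u : E}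

theorem fderiv_pullback (hφ : ContDiffAt ℝ 2 φ u) (hG : DifferentiableAt ℝ G u)
    (hG' : DifferentiableAt ℝ G' (φ u))
    (hpull : ∀ᶠ z in 𝓝 u, ∀ a b, G z a b = G' (φ z) (fderiv ℝ φ z a) (fderiv ℝ φ z b))
    (a b w : E) :
    fderiv ℝ G u a b w =
      fderiv ℝ G' (φ u) (fderiv ℝ φ u a) (fderiv ℝ φ u b) (fderiv ℝ φ u w)
      + G' (φ u) (fderiv ℝ (fderiv ℝ φ) u a b) (fderiv ℝ φ u w)
      + G' (φ u) (fderiv ℝ φ u b) (fderiv ℝ (fderiv ℝ φ) u a w) := by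
  have hφ₁ : DifferentiableAt ℝ φ u := hφ.differentiableAt (by norm_num)
  have hφ₂ : DifferentiableAt ℝ (fderiv ℝ φ) u :=
    (hφ.fderiv_right (m := 1) (by norm_num)).differentiableAt (by norm_num)
  have hφv (v : E) : DifferentiableAt ℝ (fun z ↦ fderiv ℝ φ z v) u :=
    hφ₂.clm_apply (differentiableAt_const v)
  have hφva (v : E) : fderiv ℝ (fun z ↦ fderiv ℝ φ z v) u a = fderiv ℝ (fderiv ℝ φ) u a v := by
    simp [fderiv_clm_apply hφ₂ (differentiableAt_const v)]
  have heq : (fun z ↦ G z b w) =ᶠ[𝓝 u] fun z ↦ G' (φ z) (fderiv ℝ φ z b) (fderiv ℝ φ z w) :=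
    hpull.mono fun z hz ↦ hz b w
  rw [← fderiv_bilinear_apply_const hG, heq.fderiv_eq,
    fderiv_bilinear_apply (hG'.fun_comp' u hφ₁) (hφv b) (hφv w), hφva, hφva,
    fderiv_fun_comp u hG' hφ₁, ContinuousLinearMap.comp_apply]

theorem leviCivita_pullback (hφ : ContDiffAt ℝ 2 φ u) (hG : DifferentiableAt ℝ G u)
    (hG' : DifferentiableAt ℝ G' (φ u))
    (hpull : ∀ᶠ z in 𝓝 u, ∀ a b, G z a b = G' (φ z) (fderiv ℝ φ z a) (fderiv ℝ φ z b))
    (hsymm : ∀ a b, G' (φ u) a b = G' (φ u) b a) (a b w : E) :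
    leviCivita (fderiv ℝ G u) a b w =
      leviCivita (fderiv ℝ G' (φ u)) (fderiv ℝ φ u a) (fderiv ℝ φ u b) (fderiv ℝ φ u w)
      + G' (φ u) (fderiv ℝ (fderiv ℝ φ) u a b) (fderiv ℝ φ u w) := by
  have hφsymm (v w : E) : fderiv ℝ (fderiv ℝ φ) u v w = fderiv ℝ (fderiv ℝ φ) u w v :=
    (hφ.isSymmSndFDerivAt (by simp)) v w
  simp only [leviCivita_apply, fderiv_pullback hφ hG hG' hpull]
  rw [hφsymm b a, hφsymm w a, hφsymm w b, hsymm (fderiv ℝ φ u b) (fderiv ℝ (fderiv ℝ φ) u a w)]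
  ring

/-- The equation of a parallel field with components `y` along a curve that passes at time `t`
through the coordinate point `u` with velocity `a`, for the metric `G`. As in `IsParallelAlong` the
free index is lowered, so that no inverse of the metric occurs. -/
def CoordParallelAt (G : E → E →L[ℝ] E →L[ℝ] ℝ) (u a : E) (y : ℝ → E) (t : ℝ) : Prop :=
  ∃ y' : E, HasDerivAt y y' t ∧ G u y' + leviCivita (fderiv ℝ G u) a (y t) = 0

namespace CoordParallelAt

variable {a : E} {y z : ℝ → E} {t : ℝ}

theorem congr (hy : CoordParallelAt G u a y t) (hzy : z =ᶠ[𝓝 t] y) :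
    CoordParallelAt G u a z t := by
  obtain ⟨y', hy', heq⟩ := hy
  exact ⟨y', hy'.congr_of_eventuallyEq hzy, by rwa [hzy.self_of_nhds]⟩

theorem add (hy : CoordParallelAt G u a y t) (hz : CoordParallelAt G u a z t) :
    CoordParallelAt G u a (fun s ↦ y s + z s) t := by
  obtain ⟨y', hy', hye⟩ := hy
  obtain ⟨z', hz', hze⟩ := hz
  exact ⟨y' + z', hy'.add hz', by rw [map_add, map_add, add_add_add_comm, hye, hze, add_zero]⟩

theorem const_smul (r : ℝ) (hy : CoordParallelAt G u a y t) :
    CoordParallelAt G u a (fun s ↦ r • y s) t := by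
  obtain ⟨y', hy', hye⟩ := hy
  exact ⟨r • y', hy'.const_smul r, by rw [map_smul, map_smul, ← smul_add, hye, smul_zero]⟩

theorem comp_mul_left (r : ℝ) (hy : CoordParallelAt G u a y (r * t)) :
    CoordParallelAt G u (r • a) (fun s ↦ y (r * s)) t := by
  obtain ⟨y', hy', hye⟩ := hy
  refine ⟨r • y', hy'.scomp t (by simpa using (hasDerivAt_id t).const_mul r), ?_⟩
  rw [map_smul, leviCivita_smul_left, smul_apply, ← smul_add, hye, smul_zero]

theorem hasDerivAt_inner {c : ℝ → E} (hc : HasDerivAt c a t) (hG : DifferentiableAt ℝ G (c t))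
    (hsymm : ∀ z a b, G z a b = G z b a) (hy : CoordParallelAt G (c t) a y t)
    (hz : CoordParallelAt G (c t) a z t) :
    HasDerivAt (fun s ↦ G (c s) (y s) (z s)) 0 t := by
  obtain ⟨y', hy', hye⟩ := hy
  obtain ⟨z', hz', hze⟩ := hz
  have hGc : HasDerivAt (fun s ↦ G (c s)) (fderiv ℝ G (c t) a) t :=
    hG.hasFDerivAt.comp_hasDerivAt t hc
  refine ((hGc.clm_apply hy').clm_apply hz').congr_deriv ?_
  have hyz := congr($hye (z t))
  have hzy := congr($hze (y t))
  have hcompat := leviCivita_add_swap (fderiv_bilinear_symm hG hsymm) a (y t) (z t)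
  have hswap := hsymm (c t) z' (y t)
  simp only [add_apply, zero_apply] at hyz hzy ⊢
  linarith

theorem change_coordinates {c : ℝ → E} {z : ℝ → F} (hc : HasDerivAt c a t)
    (hφ : ContDiffAt ℝ 2 φ (c t)) (hG : DifferentiableAt ℝ G (c t))
    (hG' : DifferentiableAt ℝ G' (φ (c t)))
    (hpull : ∀ᶠ z in 𝓝 (c t), ∀ a b, G z a b = G' (φ z) (fderiv ℝ φ z a) (fderiv ℝ φ z b))
    (hsymm : ∀ a b, G' (φ (c t)) a b = G' (φ (c t)) b a)
    (hsurj : Function.Surjective (fderiv ℝ φ (c t)))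
    (hz : ∀ᶠ s in 𝓝 t, z s = fderiv ℝ φ (c s) (y s))
    (hy : CoordParallelAt G (c t) a y t) :
    CoordParallelAt G' (φ (c t)) (fderiv ℝ φ (c t) a) z t := by
  obtain ⟨y', hy', hye⟩ := hy
  have hφ₂ : HasFDerivAt (fderiv ℝ φ) (fderiv ℝ (fderiv ℝ φ) (c t)) (c t) :=
    ((hφ.fderiv_right (m := 1) (by norm_num)).differentiableAt (by norm_num)).hasFDerivAt
  have hder : HasDerivAt (fun s ↦ fderiv ℝ φ (c s) (y s))
      (fderiv ℝ (fderiv ℝ φ) (c t) a (y t) + fderiv ℝ φ (c t) y') t :=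
    (hφ₂.comp_hasDerivAt t hc).clm_apply hy'
  refine ⟨_, hder.congr_of_eventuallyEq hz, ?_⟩
  ext w
  obtain ⟨w, rfl⟩ := hsurj w
  have hyw := congr($hye w)
  rw [add_apply, leviCivita_pullback hφ hG hG' hpull hsymm a (y t) w,
    hpull.self_of_nhds y' w] at hyw
  rw [hz.self_of_nhds, map_add, add_apply, add_apply]
  rw [zero_apply] at hyw ⊢
  linarith

end CoordParallelAt

theorem exists_coordParallelAt [CompleteSpace E] {c : ℝ → E} {t₀ : ℝ} (hc : ContDiffAt ℝ 1 c t₀)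
    (hG : ContDiffAt ℝ 1 G (c t₀)) (hinv : (G (c t₀)).IsInvertible) :
    ∃ ε > 0, ∀ s ∈ Metric.ball t₀ ε, ∀ v : E, ∃ y : ℝ → E, y s = v ∧
      ∀ t ∈ Metric.ball t₀ ε, CoordParallelAt G (c t) (deriv c t) y t := by
  have hG₀ : ContinuousAt (fun t ↦ G (c t)) t₀ := hG.continuousAt.comp hc.continuousAt
  have hinv' : ∀ᶠ t in 𝓝 t₀, (G (c t)).IsInvertible := by
    obtain ⟨e, he⟩ := hinv
    have hnhds := e.nhds
    rw [he] at hnhds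
    exact hG₀.eventually hnhds
  have hA : ∀ᶠ t in 𝓝 t₀, ContinuousAt
      (fun t ↦ -((G (c t)).inverse ∘L leviCivita (fderiv ℝ G (c t)) (deriv c t))) t := by
    filter_upwards [hc.eventually (by simp), hc.continuousAt.eventually (hG.eventually (by simp)),
      hinv'] with t hct hGt ht
    have hGc : ContinuousAt (fun t ↦ G (c t)) t := hGt.continuousAt.comp hct.continuousAt
    have hDc : ContinuousAt (fun t ↦ fderiv ℝ G (c t)) t :=
      (hGt.fderiv_right (m := 0) (by simp)).continuousAt.comp hct.continuousAt
    have hGinv : ContinuousAt (fun t ↦ (G (c t)).inverse) t :=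
      (ht.contDiffAt_map_inverse (n := 0)).continuousAt.comp
        (f := fun t ↦ G (c t)) hGc
    exact (hGinv.clm_comp (continuousAt_leviCivita hDc
      (hct.derivWithin (m := 0) (by simp)).continuousAt)).neg
  obtain ⟨ε₁, hε₁, hsol⟩ := exists_ball_forall_exists_hasDerivAt_clm hA
  obtain ⟨ε₂, hε₂, hinv₂⟩ := Metric.eventually_nhds_iff_ball.1 hinv'
  refine ⟨min ε₁ ε₂, lt_min hε₁ hε₂, fun s hs v ↦ ?_⟩
  obtain ⟨y, hys, hy⟩ := hsol s (Metric.ball_subset_ball (min_le_left _ _) hs) v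
  refine ⟨y, hys, fun t ht ↦ ⟨_, hy t (Metric.ball_subset_ball (min_le_left _ _) ht), ?_⟩⟩
  have hinvt : G (c t) ((G (c t)).inverse (leviCivita (fderiv ℝ G (c t)) (deriv c t) (y t))) =
      leviCivita (fderiv ℝ G (c t)) (deriv c t) (y t) :=
    congr($((hinv₂ t (Metric.ball_subset_ball (min_le_right _ _) ht)).self_comp_inverse) _)
  rw [neg_apply, map_neg, ContinuousLinearMap.comp_apply, hinvt, neg_add_cancel]

end Coordinates

section Transition

variable {H : Type*} [TopologicalSpace H] {M : Type*} [TopologicalSpace M] [ChartedSpace H M]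

/-- The change of coordinates from the chart at `c` to the chart at `c'`. -/
noncomputable def transition (c c' : M) : H → H := chartAt H c' ∘ (chartAt H c).symm

theorem transition_apply_chart {c x : M} (c' : M) (hx : x ∈ (chartAt H c).source) :
    transition (H := H) c c' (chartAt H c x) = chartAt H c' x := by
  rw [transition, Function.comp_apply, (chartAt H c).left_inv hx]

end Transition

section Charts

variable {E : Type*} [NormedAddCommGroup E] [NormedSpace ℝ E]
  {M : Type*} [TopologicalSpace M] [ChartedSpace E M]

theorem chartComponents_add (c : M) {x : M} (v w : TangentSpace 𝓘(ℝ, E) x) :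
    chartComponents c (v + w) = chartComponents c v + chartComponents c w :=
  map_add (mfderiv 𝓘(ℝ, E) 𝓘(ℝ, E) (chartAt E c) x) v w

theorem chartComponents_smul (c : M) {x : M} (r : ℝ) (v : TangentSpace 𝓘(ℝ, E) x) :
    chartComponents c (r • v) = r • chartComponents c v :=
  map_smul (mfderiv 𝓘(ℝ, E) 𝓘(ℝ, E) (chartAt E c) x) r v

/-- The tangent vector at `x` with components `a` in the chart `chartAt E c`; the inverse of
`chartComponents`. -/
noncomputable def ofComponents (c x : M) (a : E) : TangentSpace 𝓘(ℝ, E) x :=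
  (mfderiv 𝓘(ℝ, E) 𝓘(ℝ, E) (chartAt E c).symm (chartAt E c x) : E →L[ℝ] E) a

theorem contDiffAt_transition {n : WithTop ℕ∞} [IsManifold 𝓘(ℝ, E) n M] {c c' x : M}
    (hx : x ∈ (chartAt E c).source) (hx' : x ∈ (chartAt E c').source) :
    ContDiffAt ℝ n (transition (H := E) c c') (chartAt E c x) := by
  rw [← contMDiffAt_iff_contDiffAt]
  have hsymm : ContMDiffAt 𝓘(ℝ, E) 𝓘(ℝ, E) n (chartAt E c).symm (chartAt E c x) :=
    contMDiffOn_chart_symm.contMDiffAt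
      ((chartAt E c).open_target.mem_nhds ((chartAt E c).map_source hx))
  refine ContMDiffAt.comp _ ?_ hsymm
  rw [(chartAt E c).left_inv hx]
  exact contMDiffOn_chart.contMDiffAt ((chartAt E c').open_source.mem_nhds hx')

section OnceDifferentiable

variable [IsManifold 𝓘(ℝ, E) 1 M] {c x : M}

theorem ofComponents_chartComponents (hx : x ∈ (chartAt E c).source)
    (v : TangentSpace 𝓘(ℝ, E) x) : ofComponents c x (chartComponents c v) = v :=
  congr($((mdifferentiable_chart c).symm_comp_deriv hx) v)

theorem chartComponents_ofComponents (hx : x ∈ (chartAt E c).source) (a : E) :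
    chartComponents c (ofComponents c x a) = a := by
  have h := congr($((mdifferentiable_chart (I := 𝓘(ℝ, E)) c).comp_symm_deriv
    ((chartAt E c).map_source hx)) a)
  rw [(chartAt E c).left_inv hx] at h
  exact h

theorem chartComponents_eq_fderiv_transition {c' : M} (hx : x ∈ (chartAt E c).source)
    (hx' : x ∈ (chartAt E c').source) (v : TangentSpace 𝓘(ℝ, E) x) :
    chartComponents c' v =
      fderiv ℝ (transition (H := E) c c') (chartAt E c x) (chartComponents c v) := by
  have hd : MDifferentiableAt 𝓘(ℝ, E) 𝓘(ℝ, E) (transition (H := E) c c') (chartAt E c x) :=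
    ((contDiffAt_transition (n := 1) hx hx').differentiableAt (by simp)).mdifferentiableAt
  have hcomp := mfderiv_comp x hd ((mdifferentiable_chart c).mdifferentiableAt hx)
  have heq : transition (H := E) c c' ∘ chartAt E c =ᶠ[𝓝 x] chartAt E c' :=
    Filter.eventually_of_mem ((chartAt E c).open_source.mem_nhds hx)
      fun z hz ↦ transition_apply_chart c' hz
  rw [mfderiv_eq_fderiv] at hcomp
  exact congr($(heq.mfderiv_eq (I := 𝓘(ℝ, E)) (I' := 𝓘(ℝ, E))) v).symm.trans congr($hcomp v)

theorem hasDerivAt_chart_comp {γ : ℝ → M} {t : ℝ} (hγ : MDifferentiableAt 𝓘(ℝ, ℝ) 𝓘(ℝ, E) γ t)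
    (hc : γ t ∈ (chartAt E c).source) :
    HasDerivAt (fun s ↦ chartAt E c (γ s)) (chartComponents c (velocity E γ t)) t := by
  have h := ((mdifferentiable_chart c).mdifferentiableAt hc).hasMFDerivAt.comp t hγ.hasMFDerivAt
  obtain ⟨l, hl, h'⟩ : ∃ l : ℝ →L[ℝ] E, l 1 = chartComponents c (velocity E γ t) ∧
      HasFDerivAt (fun s ↦ chartAt E c (γ s)) l t := ⟨_, rfl, hasMFDerivAt_iff_hasFDerivAt.1 h⟩
  exact hl ▸ h'.hasDerivAt

end OnceDifferentiable

theorem contMDiffOn_mfderiv_chart_symm {n : WithTop ℕ∞} [IsManifold 𝓘(ℝ, E) 1 M]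
    [IsManifold 𝓘(ℝ, E) (n + 1) M] (c : M) (a : E) :
    ContMDiffOn 𝓘(ℝ, E) (𝓘(ℝ, E).prod 𝓘(ℝ, E)) n
      (fun u ↦ (⟨(chartAt E c).symm u, mfderiv 𝓘(ℝ, E) 𝓘(ℝ, E) (chartAt E c).symm u a⟩ :
        TangentBundle 𝓘(ℝ, E) M)) (chartAt E c).target := by
  have htangent := contMDiffOn_chart_symm (I := 𝓘(ℝ, E)) (n := n + 1) (x := c)
    |>.contMDiffOn_tangentMapWithin le_rfl (chartAt E c).open_target.uniqueMDiffOn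
  have hconst : ContMDiff 𝓘(ℝ, E) (𝓘(ℝ, E).prod 𝓘(ℝ, E)) n
      (fun u ↦ (⟨u, a⟩ : TangentBundle 𝓘(ℝ, E) E)) :=
    contMDiff_vectorSpace_iff_contDiff.2 contDiff_const
  refine (htangent.comp hconst.contMDiffOn fun u hu ↦ hu).congr fun u hu ↦ ?_
  simp only [tangentMapWithin, Function.comp_apply,
    mfderivWithin_of_isOpen (chartAt E c).open_target hu]

variable [RiemannianBundle (fun x : M ↦ TangentSpace 𝓘(ℝ, E) x)]

/-- The metric `chartMetric c` as a family of continuous bilinear forms, which can be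
differentiated as a function of the coordinate point. -/
noncomputable def metricForm (c : M) (u : E) : E →L[ℝ] E →L[ℝ] ℝ :=
  (innerSL ℝ (E := TangentSpace 𝓘(ℝ, E) ((chartAt E c).symm u))).bilinearComp
    (mfderiv 𝓘(ℝ, E) 𝓘(ℝ, E) (chartAt E c).symm u)
    (mfderiv 𝓘(ℝ, E) 𝓘(ℝ, E) (chartAt E c).symm u)

theorem metricForm_apply (c : M) (u a b : E) : metricForm c u a b = chartMetric c u a b := rfl

theorem metricForm_symm (c : M) (u a b : E) : metricForm c u a b = metricForm c u b a :=
  real_inner_comm (F := TangentSpace 𝓘(ℝ, E) ((chartAt E c).symm u)) _ _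

theorem metricForm_eq_inner_ofComponents {c x : M} (hx : x ∈ (chartAt E c).source) (a b : E) :
    metricForm c (chartAt E c x) a b = inner ℝ (ofComponents c x a) (ofComponents c x b) := by
  have hcast (q : M) (hq : q = x) (A : E →L[ℝ] E) :
      @inner ℝ (TangentSpace 𝓘(ℝ, E) q) _ (A a) (A b) =
        @inner ℝ (TangentSpace 𝓘(ℝ, E) x) _ (A a) (A b) := by
    subst hq; rfl
  exact hcast _ ((chartAt E c).left_inv hx)
    (mfderiv 𝓘(ℝ, E) 𝓘(ℝ, E) (chartAt E c).symm (chartAt E c x))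

section OnceDifferentiable

variable [IsManifold 𝓘(ℝ, E) 1 M] {c x : M}

theorem metricForm_chartComponents (hx : x ∈ (chartAt E c).source) (v w : TangentSpace 𝓘(ℝ, E) x) :
    metricForm c (chartAt E c x) (chartComponents c v) (chartComponents c w) = inner ℝ v w := by
  rw [metricForm_eq_inner_ofComponents hx, ofComponents_chartComponents hx,
    ofComponents_chartComponents hx]

theorem metricForm_eq_pullback_transition {c' : M} {u : E} (hu : u ∈ (chartAt E c).target)
    (hu' : (chartAt E c).symm u ∈ (chartAt E c').source) (a b : E) :
    metricForm c u a b = metricForm c' (transition c c' u)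
      (fderiv ℝ (transition (H := E) c c') u a) (fderiv ℝ (transition (H := E) c c') u b) := by
  obtain ⟨x, hx, rfl⟩ : ∃ x ∈ (chartAt E c).source, chartAt E c x = u :=
    ⟨_, (chartAt E c).map_target hu, (chartAt E c).right_inv hu⟩
  rw [(chartAt E c).left_inv hx] at hu'
  rw [← chartComponents_ofComponents hx a, ← chartComponents_ofComponents hx b,
    ← chartComponents_eq_fderiv_transition hx hu', ← chartComponents_eq_fderiv_transition hx hu',
    transition_apply_chart c' hx, metricForm_chartComponents hx, metricForm_chartComponents hu']

theorem isInvertible_metricForm [FiniteDimensional ℝ E] (hx : x ∈ (chartAt E c).source) :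
    (metricForm (E := E) c (chartAt E c x)).IsInvertible := by
  have hinj : Function.Injective (metricForm (E := E) c (chartAt E c x)) := by
    refine (injective_iff_map_eq_zero _).2 fun a ha ↦ ?_
    have hself := congr($ha a)
    rw [metricForm_eq_inner_ofComponents hx, zero_apply, inner_self_eq_zero] at hself
    rw [← chartComponents_ofComponents hx a, hself]
    exact map_zero (mfderiv 𝓘(ℝ, E) 𝓘(ℝ, E) (chartAt E c) x)
  have hfin : Module.finrank ℝ E = Module.finrank ℝ (E →L[ℝ] ℝ) := by
    rw [← (LinearMap.toContinuousLinearMap (𝕜 := ℝ) (E := E) (F' := ℝ)).finrank_eq]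
    exact (Subspace.dual_finrank_eq (K := ℝ) (V := E)).symm
  exact ⟨(LinearEquiv.ofInjectiveOfFinrankEq _ hinj hfin).toContinuousLinearEquiv, rfl⟩

end OnceDifferentiable

theorem contDiffOn_metricForm {n : WithTop ℕ∞} [FiniteDimensional ℝ E] [IsManifold 𝓘(ℝ, E) 1 M]
    [IsManifold 𝓘(ℝ, E) (n + 1) M]
    [IsContMDiffRiemannianBundle 𝓘(ℝ, E) n E (fun x : M ↦ TangentSpace 𝓘(ℝ, E) x)] (c : M) :
    ContDiffOn ℝ n (metricForm (E := E) c) (chartAt E c).target :=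
  contDiffOn_clm_apply.2 fun a ↦ contDiffOn_clm_apply.2 fun b ↦ contMDiffOn_iff_contDiffOn.1 <|
    ContMDiffOn.inner_bundle (E := fun x : M ↦ TangentSpace 𝓘(ℝ, E) x)
      (contMDiffOn_mfderiv_chart_symm c a) (contMDiffOn_mfderiv_chart_symm c b)

theorem christoffel_eq_leviCivita {c : M} {u : E} (hG : DifferentiableAt ℝ (metricForm c) u)
    (a b w : E) : christoffel c u a b w = leviCivita (fderiv ℝ (metricForm c) u) a b w := by
  simp only [leviCivita_apply, ← fderiv_bilinear_apply_const hG]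
  rfl

end Charts

section Parallel

variable {E : Type*} [NormedAddCommGroup E] [NormedSpace ℝ E]
  {M : Type*} [TopologicalSpace M] [ChartedSpace E M]
  [RiemannianBundle (fun x : M ↦ TangentSpace 𝓘(ℝ, E) x)]
  {γ : ℝ → M} {V W : ∀ t, TangentSpace 𝓘(ℝ, E) (γ t)} {t : ℝ}

/-- The equation of a parallel field along `γ` at time `t`, in the chart `chartAt E c`. -/
def IsParallelInChart (c : M) (γ : ℝ → M) (V : ∀ t, TangentSpace 𝓘(ℝ, E) (γ t)) (t : ℝ) : Prop :=
  CoordParallelAt (metricForm c) (chartAt E c (γ t)) (chartComponents c (velocity E γ t))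
    (fun s ↦ chartComponents c (V s)) t

/-- The field `V` along `γ` satisfies the equation of a parallel field at time `t`, in every chart
around `γ t`. -/
def IsParallelAt (γ : ℝ → M) (V : ∀ t, TangentSpace 𝓘(ℝ, E) (γ t)) (t : ℝ) : Prop :=
  ∀ c : M, γ t ∈ (chartAt E c).source → IsParallelInChart c γ V t

namespace IsParallelAt

theorem congr (hV : IsParallelAt γ V t) (hWV : ∀ᶠ s in 𝓝 t, W s = V s) : IsParallelAt γ W t :=
  fun c hc ↦ CoordParallelAt.congr (hV c hc) (hWV.mono fun _ hs ↦ congrArg (chartComponents c) hs)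

theorem add (hV : IsParallelAt γ V t) (hW : IsParallelAt γ W t) :
    IsParallelAt γ (fun s ↦ V s + W s) t := fun c hc ↦ by
  simpa only [IsParallelInChart, chartComponents_add] using CoordParallelAt.add (hV c hc) (hW c hc)

theorem const_smul (r : ℝ) (hV : IsParallelAt γ V t) : IsParallelAt γ (fun s ↦ r • V s) t :=
  fun c hc ↦ by
    simpa only [IsParallelInChart, chartComponents_smul] using
      CoordParallelAt.const_smul r (hV c hc)

theorem sub (hV : IsParallelAt γ V t) (hW : IsParallelAt γ W t) :
    IsParallelAt γ (fun s ↦ V s - W s) t := by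
  simpa only [neg_smul, one_smul, ← sub_eq_add_neg] using hV.add (hW.const_smul (-1))

end IsParallelAt

variable [FiniteDimensional ℝ E] [IsManifold 𝓘(ℝ, E) 2 M]
  [IsContMDiffRiemannianBundle 𝓘(ℝ, E) 1 E (fun x : M ↦ TangentSpace 𝓘(ℝ, E) x)]

theorem contDiffAt_metricForm {c x : M} (hx : x ∈ (chartAt E c).source) :
    ContDiffAt ℝ 1 (metricForm (E := E) c) (chartAt E c x) := by
  have : IsManifold 𝓘(ℝ, E) (1 + 1) M := by rwa [one_add_one_eq_two]
  exact (contDiffOn_metricForm c).contDiffAt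
    ((chartAt E c).open_target.mem_nhds ((chartAt E c).map_source hx))

theorem differentiableAt_metricForm {c x : M} (hx : x ∈ (chartAt E c).source) :
    DifferentiableAt ℝ (metricForm (E := E) c) (chartAt E c x) :=
  (contDiffAt_metricForm hx).differentiableAt one_ne_zero

theorem isParallelAlong_iff : IsParallelAlong γ V ↔ ∀ t, IsParallelAt γ V t := by
  refine forall_congr' fun t ↦ forall_congr' fun c ↦ forall_congr' fun hc ↦
    exists_congr fun V' ↦ and_congr_right fun _ ↦ ?_
  simp only [christoffel_eq_leviCivita (differentiableAt_metricForm hc), ← metricForm_apply]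
  exact ⟨fun h ↦ ContinuousLinearMap.ext h, fun h w ↦ congr($h w)⟩

theorem IsParallelInChart.change_chart (hγ : MDifferentiableAt 𝓘(ℝ, ℝ) 𝓘(ℝ, E) γ t) {c c' : M}
    (hc : γ t ∈ (chartAt E c).source) (hc' : γ t ∈ (chartAt E c').source)
    (hV : IsParallelInChart c γ V t) : IsParallelInChart c' γ V t := by
  have hφt : transition (H := E) c c' (chartAt E c (γ t)) = chartAt E c' (γ t) :=
    transition_apply_chart c' hc
  have hcomponents : ∀ᶠ s in 𝓝 t, chartComponents c' (V s) =
      fderiv ℝ (transition (H := E) c c') (chartAt E c (γ s)) (chartComponents c (V s)) := by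
    filter_upwards [hγ.continuousAt.eventually ((chartAt E c).open_source.mem_nhds hc),
      hγ.continuousAt.eventually ((chartAt E c').open_source.mem_nhds hc')] with s hs hs'
    exact chartComponents_eq_fderiv_transition hs hs' _
  have hpull : ∀ᶠ z in 𝓝 (chartAt E c (γ t)), ∀ a b, metricForm c z a b =
      metricForm c' (transition c c' z) (fderiv ℝ (transition (H := E) c c') z a)
        (fderiv ℝ (transition (H := E) c c') z b) := by
    have hu := (chartAt E c).map_source hc
    have hsource : (chartAt E c').source ∈ 𝓝 ((chartAt E c).symm (chartAt E c (γ t))) := by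
      rw [(chartAt E c).left_inv hc]
      exact (chartAt E c').open_source.mem_nhds hc'
    filter_upwards [(chartAt E c).open_target.mem_nhds hu,
      ((chartAt E c).continuousAt_symm hu).eventually hsource] with z hz hz'
    exact metricForm_eq_pullback_transition hz hz'
  have hsurj : Function.Surjective (fderiv ℝ (transition (H := E) c c') (chartAt E c (γ t))) :=
    fun w ↦ ⟨chartComponents c (ofComponents c' (γ t) w), by
      rw [← chartComponents_eq_fderiv_transition hc hc', chartComponents_ofComponents hc']⟩
  have hV' := CoordParallelAt.change_coordinates (hasDerivAt_chart_comp hγ hc)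
    (contDiffAt_transition hc hc') (differentiableAt_metricForm hc)
    (by rw [hφt]; exact differentiableAt_metricForm hc') hpull
    (metricForm_symm c' _) hsurj hcomponents hV
  rwa [hφt, ← chartComponents_eq_fderiv_transition hc hc'] at hV'

theorem IsParallelAt.hasDerivAt_inner (hγ : MDifferentiableAt 𝓘(ℝ, ℝ) 𝓘(ℝ, E) γ t)
    (hV : IsParallelAt γ V t) (hW : IsParallelAt γ W t) :
    HasDerivAt (fun s ↦ inner ℝ (V s) (W s)) 0 t := by
  have hc : γ t ∈ (chartAt E (γ t)).source := mem_chart_source E (γ t)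
  have hform := CoordParallelAt.hasDerivAt_inner (hasDerivAt_chart_comp hγ hc)
    (differentiableAt_metricForm hc) (metricForm_symm _) (hV _ hc) (hW _ hc)
  refine hform.congr_of_eventuallyEq ?_
  filter_upwards [hγ.continuousAt.eventually ((chartAt E (γ t)).open_source.mem_nhds hc)] with s hs
  exact (metricForm_chartComponents hs _ _).symm

theorem inner_eq_inner_of_isParallelAt (hγ : MDifferentiable 𝓘(ℝ, ℝ) 𝓘(ℝ, E) γ) {I : Set ℝ}
    (hI : IsOpen I) (hI' : IsPreconnected I) (hV : ∀ t ∈ I, IsParallelAt γ V t)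
    (hW : ∀ t ∈ I, IsParallelAt γ W t) {s : ℝ} (hs : s ∈ I) (ht : t ∈ I) :
    (inner ℝ (V s) (W s) : ℝ) = inner ℝ (V t) (W t) := by
  have hder : ∀ r ∈ I, HasDerivAt (fun s ↦ inner ℝ (V s) (W s)) 0 r := fun r hr ↦
    (hV r hr).hasDerivAt_inner (hγ r) (hW r hr)
  exact hI.is_const_of_deriv_eq_zero hI'
    (fun r hr ↦ (hder r hr).differentiableAt.differentiableWithinAt)
    (fun r hr ↦ (hder r hr).deriv) hs ht

theorem eqOn_of_isParallelAt (hγ : MDifferentiable 𝓘(ℝ, ℝ) 𝓘(ℝ, E) γ) {I : Set ℝ}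
    (hI : IsOpen I) (hI' : IsPreconnected I) (hV : ∀ t ∈ I, IsParallelAt γ V t)
    (hW : ∀ t ∈ I, IsParallelAt γ W t) {s : ℝ} (hs : s ∈ I) (hVW : V s = W s) (ht : t ∈ I) :
    V t = W t := by
  have hsub : ∀ r ∈ I, IsParallelAt γ (fun s ↦ V s - W s) r := fun r hr ↦
    (hV r hr).sub (hW r hr)
  have hconst := inner_eq_inner_of_isParallelAt hγ hI hI' hsub hsub ht hs
  rwa [hVW, sub_self, inner_zero_left, inner_self_eq_zero, sub_eq_zero] at hconst

theorem exists_isParallelAt_near (hγ : ContMDiff 𝓘(ℝ, ℝ) 𝓘(ℝ, E) 1 γ) (t₀ : ℝ) :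
    ∃ ε > 0, ∀ s ∈ Metric.ball t₀ ε, ∀ v : TangentSpace 𝓘(ℝ, E) (γ s),
      ∃ V : ∀ t, TangentSpace 𝓘(ℝ, E) (γ t), V s = v ∧
        ∀ t ∈ Metric.ball t₀ ε, IsParallelAt γ V t := by
  have hγd : MDifferentiable 𝓘(ℝ, ℝ) 𝓘(ℝ, E) γ := hγ.mdifferentiable one_ne_zero
  have hc₀ : γ t₀ ∈ (chartAt E (γ t₀)).source := mem_chart_source E (γ t₀)
  have hcurve : ContDiffAt ℝ 1 (fun s ↦ chartAt E (γ t₀) (γ s)) t₀ :=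
    contMDiffAt_iff_contDiffAt.1 <| ContMDiffAt.comp (I' := 𝓘(ℝ, E)) t₀
      (contMDiffOn_chart.contMDiffAt ((chartAt E (γ t₀)).open_source.mem_nhds hc₀)) (hγ t₀)
  obtain ⟨ε₁, hε₁, hsol⟩ :=
    exists_coordParallelAt hcurve (contDiffAt_metricForm hc₀) (isInvertible_metricForm hc₀)
  obtain ⟨ε₂, hε₂, hsource⟩ := Metric.eventually_nhds_iff_ball.1
    (hγ.continuous.continuousAt.eventually ((chartAt E (γ t₀)).open_source.mem_nhds hc₀))
  have hball : Metric.ball t₀ (min ε₁ ε₂) ⊆ Metric.ball t₀ ε₁ ∩ Metric.ball t₀ ε₂ :=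
    fun t ht ↦ ⟨Metric.ball_subset_ball (min_le_left _ _) ht,
      Metric.ball_subset_ball (min_le_right _ _) ht⟩
  refine ⟨min ε₁ ε₂, lt_min hε₁ hε₂, fun s hs v ↦ ?_⟩
  obtain ⟨y, hys, hy⟩ := hsol s (hball hs).1 (chartComponents (γ t₀) v)
  refine ⟨fun t ↦ ofComponents (γ t₀) (γ t) (y t), ?_, fun t ht c' hc' ↦ ?_⟩
  · simp only [hys]
    exact ofComponents_chartComponents (hsource s (hball hs).2) v
  · have hct := hsource t (hball ht).2
    have hyt := hy t (hball ht).1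
    rw [(hasDerivAt_chart_comp (hγd t) hct).deriv] at hyt
    refine IsParallelInChart.change_chart (hγd t) hct hc' (hyt.congr ?_)
    filter_upwards [Metric.isOpen_ball.mem_nhds ht] with r hr
    exact chartComponents_ofComponents (hsource r (hball hr).2) _

theorem isUniquelySolvable_isParallelAt (hγ : ContMDiff 𝓘(ℝ, ℝ) 𝓘(ℝ, E) 1 γ) :
    IsUniquelySolvable (IsParallelAt (E := E) γ) where
  congr := IsParallelAt.congr
  eqOn hI hI' hV hW hs hVW _ ht :=
    eqOn_of_isParallelAt (hγ.mdifferentiable one_ne_zero) hI hI' hV hW hs hVW ht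
  exists_near := exists_isParallelAt_near hγ

theorem exists_isParallelAlong (hγ : ContMDiff 𝓘(ℝ, ℝ) 𝓘(ℝ, E) 1 γ) (s : ℝ)
    (v : TangentSpace 𝓘(ℝ, E) (γ s)) :
    ∃ V : ∀ t, TangentSpace 𝓘(ℝ, E) (γ t), V s = v ∧ IsParallelAlong γ V := by
  simp only [isParallelAlong_iff]
  exact (isUniquelySolvable_isParallelAt hγ).exists_forall s v

namespace IsParallelAlong

theorem add (hV : IsParallelAlong γ V) (hW : IsParallelAlong γ W) :
    IsParallelAlong γ (fun s ↦ V s + W s) :=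
  isParallelAlong_iff.2 fun t ↦ (isParallelAlong_iff.1 hV t).add (isParallelAlong_iff.1 hW t)

theorem sub (hV : IsParallelAlong γ V) (hW : IsParallelAlong γ W) :
    IsParallelAlong γ (fun s ↦ V s - W s) :=
  isParallelAlong_iff.2 fun t ↦ (isParallelAlong_iff.1 hV t).sub (isParallelAlong_iff.1 hW t)

theorem const_smul (hV : IsParallelAlong γ V) (r : ℝ) : IsParallelAlong γ (fun s ↦ r • V s) :=
  isParallelAlong_iff.2 fun t ↦ (isParallelAlong_iff.1 hV t).const_smul r

theorem inner_eq (hγ : MDifferentiable 𝓘(ℝ, ℝ) 𝓘(ℝ, E) γ) (hV : IsParallelAlong γ V)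
    (hW : IsParallelAlong γ W) (s t : ℝ) : (inner ℝ (V s) (W s) : ℝ) = inner ℝ (V t) (W t) :=
  inner_eq_inner_of_isParallelAt hγ isOpen_univ isPreconnected_univ
    (fun r _ ↦ isParallelAlong_iff.1 hV r) (fun r _ ↦ isParallelAlong_iff.1 hW r)
    (Set.mem_univ s) (Set.mem_univ t)

theorem norm_eq (hγ : MDifferentiable 𝓘(ℝ, ℝ) 𝓘(ℝ, E) γ) (hV : IsParallelAlong γ V) (s t : ℝ) :
    ‖V s‖ = ‖V t‖ := by
  rw [norm_eq_sqrt_real_inner, norm_eq_sqrt_real_inner, hV.inner_eq hγ hV s t]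

theorem eq_of_eq (hγ : MDifferentiable 𝓘(ℝ, ℝ) 𝓘(ℝ, E) γ) (hV : IsParallelAlong γ V)
    (hW : IsParallelAlong γ W) {s : ℝ} (hs : V s = W s) (t : ℝ) : V t = W t := by
  have hnorm := (hV.sub hW).norm_eq hγ t s
  rwa [hs, sub_self, norm_zero, norm_eq_zero, sub_eq_zero] at hnorm

theorem parallelTransport_eq (hγ : MDifferentiable 𝓘(ℝ, ℝ) 𝓘(ℝ, E) γ)
    (hV : IsParallelAlong γ V) (s t : ℝ) : parallelTransport γ s t ⟨γ s, V s⟩ = V t := by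
  have hex : ∃ W : ∀ r, TangentSpace 𝓘(ℝ, E) (γ r), IsParallelAlong γ W ∧
      (⟨γ s, W s⟩ : TangentBundle 𝓘(ℝ, E) M) = ⟨γ s, V s⟩ := ⟨V, hV, rfl⟩
  rw [parallelTransport, dif_pos hex]
  exact hex.choose_spec.1.eq_of_eq hγ hV (TotalSpace.mk_injective _ hex.choose_spec.2) t

end IsParallelAlong

end Parallel

section Geodesics

variable {E : Type*} [NormedAddCommGroup E] [NormedSpace ℝ E]
  {M : Type*} [TopologicalSpace M] [ChartedSpace E M] {γ : ℝ → M}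

theorem velocity_comp_mul_left (hγ : MDifferentiable 𝓘(ℝ, ℝ) 𝓘(ℝ, E) γ) (r t : ℝ) :
    velocity E (fun s ↦ γ (r * s)) t = r • velocity E γ (r * t) := by
  have hmul : HasMFDerivAt 𝓘(ℝ, ℝ) 𝓘(ℝ, ℝ) (fun s : ℝ ↦ r * s) t
      (ContinuousLinearMap.toSpanSingleton ℝ r) := by
    have hderiv : HasDerivAt (fun s : ℝ ↦ r * s) r t := by
      simpa only [mul_one] using (hasDerivAt_id' t).const_mul r
    exact hderiv.hasFDerivAt.hasMFDerivAt
  have hchain := DFunLike.congr_fun ((hγ (r * t)).hasMFDerivAt.comp t hmul).mfderiv (1 : ℝ)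
  exact hchain.trans <| (congrArg (mfderiv 𝓘(ℝ, ℝ) 𝓘(ℝ, E) γ (r * t) : ℝ →L[ℝ] E)
    (ContinuousLinearMap.toSpanSingleton_apply ℝ r 1 |>.trans (one_smul ℝ r) |>.trans
      (mul_one r).symm)).trans (map_smul (mfderiv 𝓘(ℝ, ℝ) 𝓘(ℝ, E) γ (r * t) : ℝ →L[ℝ] E) r (1 : ℝ))

variable [RiemannianBundle (fun x : M ↦ TangentSpace 𝓘(ℝ, E) x)]

theorem IsGeodesic.mdifferentiable (hγ : IsGeodesic E γ) : MDifferentiable 𝓘(ℝ, ℝ) 𝓘(ℝ, E) γ :=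
  hγ.1.mdifferentiable (by simp)

theorem IsGeodesic.contMDiff_one (hγ : IsGeodesic E γ) : ContMDiff 𝓘(ℝ, ℝ) 𝓘(ℝ, E) 1 γ :=
  hγ.1.of_le (by simp)

theorem GeodesicallyComplete.isGeodesicFrom (hM : GeodesicallyComplete E M) (x : M)
    (v : TangentSpace 𝓘(ℝ, E) x) : IsGeodesicFrom (geodesicFrom x v) x v := by
  rw [geodesicFrom, dif_pos (hM x v)]
  exact (hM x v).choose_spec

variable [FiniteDimensional ℝ E]

theorem inner_riemGrad (h : M → ℝ) (x : M) (v : TangentSpace 𝓘(ℝ, E) x) :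
    inner ℝ (riemGrad E h x) v = mfderiv 𝓘(ℝ, E) 𝓘(ℝ, ℝ) h x v :=
  InnerProductSpace.toDual_symm_apply

theorem hasDerivAt_comp_curve {h : M → ℝ} (hh : MDifferentiable 𝓘(ℝ, E) 𝓘(ℝ, ℝ) h)
    (hγ : MDifferentiable 𝓘(ℝ, ℝ) 𝓘(ℝ, E) γ) (t : ℝ) :
    HasDerivAt (fun s ↦ h (γ s)) (inner ℝ (riemGrad E h (γ t)) (velocity E γ t)) t := by
  rw [inner_riemGrad]
  obtain ⟨h', hh', hchain⟩ : ∃ h' : ℝ →L[ℝ] ℝ,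
      h' 1 = mfderiv 𝓘(ℝ, E) 𝓘(ℝ, ℝ) h (γ t) (velocity E γ t) ∧
      HasFDerivAt (fun s ↦ h (γ s)) h' t :=
    ⟨_, rfl, hasMFDerivAt_iff_hasFDerivAt.1 <|
      (hh (γ t)).hasMFDerivAt.comp t (hγ t).hasMFDerivAt⟩
  exact hh' ▸ hchain.hasDerivAt

section

variable [IsManifold 𝓘(ℝ, E) 2 M]
  [IsContMDiffRiemannianBundle 𝓘(ℝ, E) 1 E (fun x : M ↦ TangentSpace 𝓘(ℝ, E) x)]
  {V : ∀ t, TangentSpace 𝓘(ℝ, E) (γ t)}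

theorem IsParallelAlong.comp_mul_left (hγ : MDifferentiable 𝓘(ℝ, ℝ) 𝓘(ℝ, E) γ)
    (hV : IsParallelAlong γ V) (r : ℝ) :
    IsParallelAlong (fun s ↦ γ (r * s)) (fun s ↦ V (r * s)) := by
  rw [isParallelAlong_iff] at hV ⊢
  intro t c hc
  rw [IsParallelInChart, velocity_comp_mul_left hγ, chartComponents_smul]
  exact CoordParallelAt.comp_mul_left r (hV (r * t) c hc)

theorem IsGeodesic.comp_mul_left (hγ : IsGeodesic E γ) (r : ℝ) :
    IsGeodesic E (fun s ↦ γ (r * s)) := by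
  have hvelocity : velocity E (fun s ↦ γ (r * s)) = fun s ↦ r • velocity E γ (r * s) :=
    funext (velocity_comp_mul_left hγ.mdifferentiable r)
  refine ⟨hγ.1.comp (contDiff_const.mul contDiff_id).contMDiff, ?_⟩
  rw [hvelocity]
  exact (hγ.2.comp_mul_left hγ.mdifferentiable r).const_smul r

theorem exists_linearIsometry_eq_parallelTransport (hγ : ContMDiff 𝓘(ℝ, ℝ) 𝓘(ℝ, E) 1 γ)
    (s t : ℝ) :
    ∃ T : TangentSpace 𝓘(ℝ, E) (γ s) →ₗᵢ[ℝ] TangentSpace 𝓘(ℝ, E) (γ t),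
      ∀ w, parallelTransport γ s t ⟨γ s, w⟩ = T w := by
  have hγd : MDifferentiable 𝓘(ℝ, ℝ) 𝓘(ℝ, E) γ := hγ.mdifferentiable one_ne_zero
  choose V hVs hV using exists_isParallelAlong hγ s
  have htransport : ∀ w, parallelTransport γ s t ⟨γ s, w⟩ = V w t := fun w ↦ by
    rw [← (hV w).parallelTransport_eq hγd s t, hVs]
  refine ⟨⟨⟨⟨fun w ↦ V w t, fun w w' ↦ ?_⟩, fun r w ↦ ?_⟩, fun w ↦ ?_⟩, htransport⟩
  · exact (hV _).eq_of_eq hγd ((hV w).add (hV w')) (s := s) (by simp only [hVs]) t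
  · exact (hV _).eq_of_eq hγd ((hV w).const_smul r) (s := s) (by simp only [hVs]) t
  · exact ((hV w).norm_eq hγd t s).trans (congrArg norm (hVs w))

namespace GSmooth

variable {L : ℝ} {h : M → ℝ}

theorem norm_riemGrad_sub_le (hh : GSmooth E L h) (hγ : IsGeodesic E γ)
    (hV : IsParallelAlong γ V) {t : ℝ} (ht : 0 ≤ t) (hVt : V t = riemGrad E h (γ t)) :
    ‖riemGrad E h (γ 0) - V 0‖ ≤ L * (t * ‖velocity E γ 0‖) := by
  have hγd := hγ.mdifferentiable
  have htransport := (hV.comp_mul_left hγd t).parallelTransport_eq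
    (hγ.comp_mul_left t).mdifferentiable 1 0
  have hsmooth := hh.2 _ (hγ.comp_mul_left t)
  have hend : V (t * 1) = riemGrad E h (γ (t * 1)) := by rwa [mul_one]
  rw [hend] at htransport
  rwa [htransport, velocity_comp_mul_left hγd, mul_zero, norm_smul, Real.norm_of_nonneg ht]
    at hsmooth

theorem inner_velocity_le (hh : GSmooth E L h) (hγ : IsGeodesic E γ) {t : ℝ} (ht : 0 ≤ t) :
    inner ℝ (riemGrad E h (γ t)) (velocity E γ t) ≤
      inner ℝ (riemGrad E h (γ 0)) (velocity E γ 0) + L * t * ‖velocity E γ 0‖ ^ 2 := by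
  obtain ⟨V, hVt, hV⟩ := exists_isParallelAlong hγ.contMDiff_one t (riemGrad E h (γ t))
  calc inner ℝ (riemGrad E h (γ t)) (velocity E γ t)
    _ = inner ℝ (V 0) (velocity E γ 0) := by rw [← hVt, hV.inner_eq hγ.mdifferentiable hγ.2 t 0]
    _ = inner ℝ (riemGrad E h (γ 0)) (velocity E γ 0)
        + inner ℝ (V 0 - riemGrad E h (γ 0)) (velocity E γ 0) := by
      rw [inner_sub_left, add_sub_cancel]
    _ ≤ inner ℝ (riemGrad E h (γ 0)) (velocity E γ 0)
        + L * (t * ‖velocity E γ 0‖) * ‖velocity E γ 0‖ := by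
      have hclose := hh.norm_riemGrad_sub_le hγ hV ht hVt
      rw [norm_sub_rev] at hclose
      gcongr
      exact (real_inner_le_norm _ _).trans (by gcongr)
    _ = inner ℝ (riemGrad E h (γ 0)) (velocity E γ 0) + L * t * ‖velocity E γ 0‖ ^ 2 := by ring

theorem le_along_geodesic (hh : GSmooth E L h) (hγ : IsGeodesic E γ) {t : ℝ} (ht : 0 ≤ t) :
    h (γ t) ≤ h (γ 0) + t * inner ℝ (riemGrad E h (γ 0)) (velocity E γ 0)
      + L / 2 * t ^ 2 * ‖velocity E γ 0‖ ^ 2 := by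
  set D : ℝ := inner ℝ (riemGrad E h (γ 0)) (velocity E γ 0)
  set N : ℝ := ‖velocity E γ 0‖ ^ 2
  have hderiv : ∀ s, HasDerivAt (fun s ↦ h (γ s) - (s * D + L / 2 * s ^ 2 * N))
      (inner ℝ (riemGrad E h (γ s)) (velocity E γ s) - (D + L * s * N)) s := fun s ↦ by
    have hlinear : HasDerivAt (fun s : ℝ ↦ s * D) D s := by
      simpa only [one_mul] using (hasDerivAt_id' s).mul_const D
    have hquadratic : HasDerivAt (fun s : ℝ ↦ L / 2 * s ^ 2 * N) (L * s * N) s := by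
      refine (((hasDerivAt_pow 2 s).const_mul (L / 2)).mul_const N).congr_deriv ?_
      rw [Nat.add_one_sub_one, pow_one, Nat.cast_ofNat]
      ring
    exact (hasDerivAt_comp_curve hh.1 hγ.mdifferentiable s).sub (hlinear.add hquadratic)
  have hanti := antitoneOn_of_deriv_nonpos (convex_Ici (0 : ℝ))
    (fun s _ ↦ (hderiv s).continuousAt.continuousWithinAt)
    (fun s _ ↦ (hderiv s).differentiableAt.differentiableWithinAt)
    (fun s hs ↦ by
      rw [interior_Ici] at hs
      rw [(hderiv s).deriv]
      linarith only [hh.inner_velocity_le hγ (le_of_lt hs)])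
  have hle := hanti Set.self_mem_Ici ht ht
  simp only at hle
  linarith only [hle]

end GSmooth

variable {L : ℝ} {h : M → ℝ} {x : M} {v : TangentSpace 𝓘(ℝ, E) x}

theorem IsGeodesicFrom.exists_linearIsometry_eq_parallelTransport (hγ : IsGeodesicFrom γ x v) :
    ∃ T : TangentSpace 𝓘(ℝ, E) x →ₗᵢ[ℝ] TangentSpace 𝓘(ℝ, E) (γ 1),
      ∀ w, parallelTransport γ 0 1 ⟨x, w⟩ = T w := by
  obtain ⟨hgeo, hinit⟩ := hγ
  cases hinit
  exact RPage.exists_linearIsometry_eq_parallelTransport hgeo.contMDiff_one 0 1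

theorem IsGeodesicFrom.norm_riemGrad_sub_parallelTransport_le (hγ : IsGeodesicFrom γ x v)
    (hh : GSmooth E L h) :
    ‖riemGrad E h (γ 1) - parallelTransport γ 0 1 ⟨x, riemGrad E h x⟩‖ ≤ L * ‖v‖ := by
  obtain ⟨hgeo, hinit⟩ := hγ
  cases hinit
  obtain ⟨V, hV0, hV⟩ := exists_isParallelAlong hgeo.contMDiff_one 0 (riemGrad E h (γ 0))
  obtain ⟨W, hW1, hW⟩ := exists_isParallelAlong hgeo.contMDiff_one 1 (riemGrad E h (γ 1))
  calc ‖riemGrad E h (γ 1) - parallelTransport γ 0 1 ⟨γ 0, riemGrad E h (γ 0)⟩‖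
    _ = ‖W 1 - V 1‖ := by rw [← hV0, hV.parallelTransport_eq hgeo.mdifferentiable, hW1]
    _ = ‖W 0 - V 0‖ := (hW.sub hV).norm_eq hgeo.mdifferentiable 1 0
    _ = ‖riemGrad E h (γ 0) - W 0‖ := by rw [hV0, norm_sub_rev]
    _ ≤ L * ‖velocity E γ 0‖ := by
      simpa only [one_mul] using hh.norm_riemGrad_sub_le hgeo hW zero_le_one hW1

theorem GSmooth.le_of_isGeodesicFrom (hh : GSmooth E L h) (hγ : IsGeodesicFrom γ x v) :
    h (γ 1) ≤ h x + inner ℝ (riemGrad E h x) v + L / 2 * ‖v‖ ^ 2 := by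
  obtain ⟨hgeo, hinit⟩ := hγ
  cases hinit
  simpa only [one_mul, one_pow, mul_one] using hh.le_along_geodesic hgeo zero_le_one

namespace GeodesicallyComplete

theorem exists_linearIsometry_eq_expTransport (hM : GeodesicallyComplete E M) (x : M)
    (v : TangentSpace 𝓘(ℝ, E) x) :
    ∃ T : TangentSpace 𝓘(ℝ, E) x →ₗᵢ[ℝ] TangentSpace 𝓘(ℝ, E) (riemExp x v),
      ∀ w, expTransport x v w = T w :=
  (hM.isGeodesicFrom x v).exists_linearIsometry_eq_parallelTransport

theorem norm_riemGrad_riemExp_sub_expTransport_le (hM : GeodesicallyComplete E M)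
    (hh : GSmooth E L h) (x : M) (v : TangentSpace 𝓘(ℝ, E) x) :
    ‖riemGrad E h (riemExp x v) - expTransport x v (riemGrad E h x)‖ ≤ L * ‖v‖ :=
  (hM.isGeodesicFrom x v).norm_riemGrad_sub_parallelTransport_le hh

theorem riemExp_le (hM : GeodesicallyComplete E M) (hh : GSmooth E L h) (x : M)
    (v : TangentSpace 𝓘(ℝ, E) x) :
    h (riemExp x v) ≤ h x + inner ℝ (riemGrad E h x) v + L / 2 * ‖v‖ ^ 2 :=
  hh.le_of_isGeodesicFrom (hM.isGeodesicFrom x v)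

end GeodesicallyComplete

end

end Geodesics

section Sampling

variable {ι : Type*}

theorem sum_powersetCard_sum {A : Type*} [AddCommMonoid A] {b : ℕ} (hb : 0 < b) (t : Finset ι)
    (φ : ι → A) :
    ∑ S ∈ t.powersetCard b, ∑ i ∈ S, φ i = (t.card - 1).choose (b - 1) • ∑ i ∈ t, φ i := by
  classical
  rw [Finset.sum_comm' (t' := t) (s' := fun i ↦ (t.powersetCard b).filter ({i} ⊆ ·))]
  · rw [Finset.smul_sum]
    refine Finset.sum_congr rfl fun i hi ↦ ?_
    rw [Finset.sum_const, Finset.card_filter_powersetCard_subset _ _ _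
      (Finset.singleton_subset_iff.2 hi) (by rwa [Finset.card_singleton]), Finset.card_singleton]
  · intro S i
    simp only [Finset.mem_filter, Finset.mem_powersetCard, Finset.singleton_subset_iff]
    exact ⟨fun h ↦ ⟨h, h.1.1 h.2⟩, fun h ↦ h.1⟩

theorem exists_sum_powersetCard_sum_offDiag_eq_smul {A : Type*} [AddCommMonoid A] (b : ℕ)
    (t : Finset ι) (φ : ι × ι → A) :
    ∃ c : ℕ, ∑ S ∈ t.powersetCard b, ∑ q ∈ S.offDiag, φ q = c • ∑ q ∈ t.offDiag, φ q := by
  classical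
  rcases Nat.lt_or_ge b 2 with hb | hb
  · refine ⟨0, (Finset.sum_eq_zero fun S hS ↦ Finset.sum_eq_zero fun q hq ↦ ?_).trans
      (zero_smul ℕ _).symm⟩
    have hcard : S.card ≤ 1 := by
      rw [(Finset.mem_powersetCard.1 hS).2]
      exact Nat.le_of_lt_succ hb
    obtain ⟨hq₁, hq₂, hne⟩ := Finset.mem_offDiag.1 hq
    exact absurd (Finset.card_le_one.1 hcard _ hq₁ _ hq₂) hne
  refine ⟨(t.card - 2).choose (b - 2), ?_⟩
  rw [Finset.sum_comm' (t' := t.offDiag)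
    (s' := fun q ↦ (t.powersetCard b).filter ({q.1, q.2} ⊆ ·))]
  · rw [Finset.smul_sum]
    refine Finset.sum_congr rfl fun q hq ↦ ?_
    obtain ⟨hq₁, hq₂, hne⟩ := Finset.mem_offDiag.1 hq
    have hpair : ({q.1, q.2} : Finset ι).card = 2 := Finset.card_pair hne
    rw [Finset.sum_const, Finset.card_filter_powersetCard_subset _ _ _
      (Finset.insert_subset hq₁ (Finset.singleton_subset_iff.2 hq₂)) (hpair.trans_le hb), hpair]
  · intro S q
    simp only [Finset.mem_filter, Finset.mem_powersetCard, Finset.mem_offDiag,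
      Finset.insert_subset_iff, Finset.singleton_subset_iff]
    exact ⟨fun h ↦ ⟨⟨h.1, h.2.1, h.2.2.1⟩, h.1.1 h.2.1, h.1.1 h.2.2.1, h.2.2.2⟩,
      fun h ↦ ⟨h.1.1, h.1.2.1, h.1.2.2, h.2.2.2⟩⟩

theorem inv_choose_mul_choose_pred {n b : ℕ} (hb : 0 < b) (hbn : b ≤ n) :
    (n.choose b : ℝ)⁻¹ * (n - 1).choose (b - 1) = b / n := by
  obtain ⟨b, rfl⟩ := Nat.exists_eq_succ_of_ne_zero hb.ne'
  obtain ⟨n, rfl⟩ := Nat.exists_eq_succ_of_ne_zero (hb.trans_le hbn).ne'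
  have hchoose : ((n.succ.choose b.succ : ℕ) : ℝ) ≠ 0 :=
    Nat.cast_ne_zero.2 (Nat.choose_pos hbn).ne'
  have hn : ((n.succ : ℕ) : ℝ) ≠ 0 := Nat.cast_ne_zero.2 n.succ_ne_zero
  rw [eq_div_iff hn, inv_mul_eq_div, div_mul_eq_mul_div, div_eq_iff hchoose, mul_comm,
    mul_comm (b.succ : ℝ)]
  exact_mod_cast Nat.add_one_mul_choose_eq n b

section

variable {V : Type*} [AddCommGroup V] [Module ℝ V]

theorem sum_sub_mean_eq_zero (t : Finset ι) (a : ι → V) :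
    ∑ i ∈ t, (a i - (t.card : ℝ)⁻¹ • ∑ j ∈ t, a j) = 0 := by
  rcases t.eq_empty_or_nonempty with rfl | ht
  · exact Finset.sum_empty
  · have hcard : (t.card : ℝ) ≠ 0 := Nat.cast_ne_zero.2 ht.card_pos.ne'
    rw [Finset.sum_sub_distrib, Finset.sum_const, ← Nat.cast_smul_eq_nsmul ℝ,
      smul_inv_smul₀ hcard, sub_self]

theorem batchMean_sub_mean {b : ℕ} (hb : 0 < b) {t S : Finset ι} (hS : S ∈ t.powersetCard b)
    (a : ι → V) (m : V) :
    (b : ℝ)⁻¹ • ∑ i ∈ S, a i - m = (b : ℝ)⁻¹ • ∑ i ∈ S, (a i - m) := by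
  have hb' : (b : ℝ) ≠ 0 := Nat.cast_ne_zero.2 hb.ne'
  rw [Finset.sum_sub_distrib, Finset.sum_const, (Finset.mem_powersetCard.1 hS).2,
    ← Nat.cast_smul_eq_nsmul ℝ, smul_sub, inv_smul_smul₀ hb']

end

variable {H : Type*} [NormedAddCommGroup H] [InnerProductSpace ℝ H]

theorem norm_sq_sum_eq_sum_add_sum_offDiag (t : Finset ι) (d : ι → H) :
    ‖∑ i ∈ t, d i‖ ^ 2 = ∑ i ∈ t, ‖d i‖ ^ 2 + ∑ q ∈ t.offDiag, inner ℝ (d q.1) (d q.2) := by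
  classical
  simp only [← real_inner_self_eq_norm_sq, sum_inner, inner_sum]
  rw [← Finset.sum_product', ← Finset.diag_union_offDiag,
    Finset.sum_union (Finset.disjoint_diag_offDiag t), Finset.sum_diag]
  simp only [real_inner_comm]

-- Off-diagonal pairs all occur equally often, and their inner products sum to `-∑ ‖d i‖²`.
theorem sum_powersetCard_norm_sq_sum_le {b : ℕ} (hb : 0 < b) {t : Finset ι} {d : ι → H}
    (hd : ∑ i ∈ t, d i = 0) :
    ∑ S ∈ t.powersetCard b, ‖∑ i ∈ S, d i‖ ^ 2
      ≤ (t.card - 1).choose (b - 1) * ∑ i ∈ t, ‖d i‖ ^ 2 := by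
  classical
  have hoffDiag : ∑ q ∈ t.offDiag, inner ℝ (d q.1) (d q.2) = -∑ i ∈ t, ‖d i‖ ^ 2 := by
    have hzero := norm_sq_sum_eq_sum_add_sum_offDiag t d
    rw [hd, norm_zero, zero_pow two_ne_zero] at hzero
    linarith only [hzero]
  obtain ⟨c, hc⟩ :=
    exists_sum_powersetCard_sum_offDiag_eq_smul b t fun q ↦ (inner ℝ (d q.1) (d q.2) : ℝ)
  have hnonneg : 0 ≤ (c : ℝ) * ∑ i ∈ t, ‖d i‖ ^ 2 := by positivity
  simp only [norm_sq_sum_eq_sum_add_sum_offDiag]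
  rw [Finset.sum_add_distrib, sum_powersetCard_sum hb, hc, hoffDiag, nsmul_eq_mul, nsmul_eq_mul]
  linarith only [hnonneg]

theorem sum_norm_sub_mean_sq_le (t : Finset ι) (a : ι → H) :
    ∑ i ∈ t, ‖a i - (t.card : ℝ)⁻¹ • ∑ j ∈ t, a j‖ ^ 2 ≤ ∑ i ∈ t, ‖a i‖ ^ 2 := by
  set m : H := (t.card : ℝ)⁻¹ • ∑ j ∈ t, a j
  have hexpand : ∀ i, ‖a i‖ ^ 2 = ‖a i - m‖ ^ 2 + 2 * inner ℝ (a i - m) m + ‖m‖ ^ 2 := fun i ↦ by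
    rw [← norm_add_sq_real, sub_add_cancel]
  have hcross : ∑ i ∈ t, 2 * (inner ℝ (a i - m) m : ℝ) = 0 := by
    rw [← Finset.mul_sum, ← sum_inner, sum_sub_mean_eq_zero, inner_zero_left, mul_zero]
  have hnonneg : 0 ≤ ∑ _i ∈ t, ‖m‖ ^ 2 := Finset.sum_nonneg fun _ _ ↦ sq_nonneg _
  simp only [hexpand, Finset.sum_add_distrib, hcross]
  linarith only [hnonneg]

theorem mean_norm_sq_add_batchMean_sub_mean_le {b : ℕ} {t : Finset ι} (hb : 0 < b)
    (hbt : b ≤ t.card) (e : H) (a : ι → H) :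
    (t.card.choose b : ℝ)⁻¹ * ∑ S ∈ t.powersetCard b,
        ‖e + ((b : ℝ)⁻¹ • ∑ i ∈ S, a i - (t.card : ℝ)⁻¹ • ∑ i ∈ t, a i)‖ ^ 2
      ≤ ‖e‖ ^ 2 + (b : ℝ)⁻¹ * ((t.card : ℝ)⁻¹ * ∑ i ∈ t, ‖a i‖ ^ 2) := by
  set m : H := (t.card : ℝ)⁻¹ • ∑ i ∈ t, a i
  have hcentred : ∑ i ∈ t, (a i - m) = 0 := sum_sub_mean_eq_zero t a
  have hb' : (b : ℝ) ≠ 0 := Nat.cast_ne_zero.2 hb.ne'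
  have hchoose : (t.card.choose b : ℝ) ≠ 0 := Nat.cast_ne_zero.2 (Nat.choose_pos hbt).ne'
  have hexpand : ∀ S ∈ t.powersetCard b, ‖e + ((b : ℝ)⁻¹ • ∑ i ∈ S, a i - m)‖ ^ 2 =
      ‖e‖ ^ 2 + 2 * (b : ℝ)⁻¹ * inner ℝ e (∑ i ∈ S, (a i - m))
        + (b : ℝ)⁻¹ ^ 2 * ‖∑ i ∈ S, (a i - m)‖ ^ 2 := fun S hS ↦ by
    rw [batchMean_sub_mean hb hS, norm_add_sq_real, norm_smul, real_inner_smul_right, mul_pow,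
      norm_inv, Real.norm_natCast]
    ring
  calc (t.card.choose b : ℝ)⁻¹ * ∑ S ∈ t.powersetCard b,
        ‖e + ((b : ℝ)⁻¹ • ∑ i ∈ S, a i - m)‖ ^ 2
    _ = ‖e‖ ^ 2 + (t.card.choose b : ℝ)⁻¹ * (b : ℝ)⁻¹ ^ 2
        * ∑ S ∈ t.powersetCard b, ‖∑ i ∈ S, (a i - m)‖ ^ 2 := by
      rw [Finset.sum_congr rfl hexpand, Finset.sum_add_distrib, Finset.sum_add_distrib,
        ← Finset.mul_sum, ← Finset.mul_sum, ← inner_sum, sum_powersetCard_sum hb, hcentred,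
        smul_zero, inner_zero_right, mul_zero, add_zero, Finset.sum_const,
        Finset.card_powersetCard, nsmul_eq_mul, mul_add, inv_mul_cancel_left₀ hchoose, mul_assoc]
    _ ≤ ‖e‖ ^ 2 + (t.card.choose b : ℝ)⁻¹ * (b : ℝ)⁻¹ ^ 2
        * ((t.card - 1).choose (b - 1) * ∑ i ∈ t, ‖a i‖ ^ 2) := by
      gcongr
      exact (sum_powersetCard_norm_sq_sum_le hb hcentred).trans
        (mul_le_mul_of_nonneg_left (sum_norm_sub_mean_sq_le t a) (Nat.cast_nonneg _))
    _ = ‖e‖ ^ 2 + (b : ℝ)⁻¹ ^ 2 * (b / t.card) * ∑ i ∈ t, ‖a i‖ ^ 2 := by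
      rw [← inv_choose_mul_choose_pred hb hbt]
      ring
    _ = ‖e‖ ^ 2 + (b : ℝ)⁻¹ * ((t.card : ℝ)⁻¹ * ∑ i ∈ t, ‖a i‖ ^ 2) := by field_simp

end Sampling

section Laws

instance (n m : ℕ) : Fintype (Batch n m) :=
  inferInstanceAs (Fintype {S : Finset (Fin n) // S.card = m})

instance (n m : ℕ) : MeasurableSingletonClass (Batch n m) := ⟨fun _ ↦ trivial⟩

theorem integral_uniformOn_univ {α : Type*} [Fintype α] [MeasurableSpace α]
    [MeasurableSingletonClass α] {F : Type*} [NormedAddCommGroup F] [NormedSpace ℝ F]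
    [CompleteSpace F] (h : α → F) :
    ∫ a, h a ∂(uniformOn (Set.univ : Set α)) = (Fintype.card α : ℝ)⁻¹ • ∑ a, h a := by
  rw [integral_fintype Integrable.of_finite, Finset.smul_sum]
  refine Finset.sum_congr rfl fun a _ ↦ ?_
  rw [measureReal_def, uniformOn_univ, Measure.count_singleton, one_div, ENNReal.toReal_inv,
    ENNReal.toReal_natCast]

theorem card_batch (n b : ℕ) : Fintype.card (Batch n b) = n.choose b :=
  (Fintype.card_congr (Equiv.refl _)).trans <| (Fintype.card_finset_len b).trans <| by
    rw [Fintype.card_fin]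

theorem sum_batch {A : Type*} [AddCommMonoid A] (n b : ℕ) (h : Finset (Fin n) → A) :
    ∑ S : Batch n b, h S.1 = ∑ S ∈ Finset.powersetCard b Finset.univ, h S :=
  (Finset.sum_subtype (p := fun S : Finset (Fin n) ↦ S.card = b) _
    (fun _ ↦ Finset.mem_powersetCard_univ) h).symm

theorem isProbabilityMeasure_uniformOn_batch {n b : ℕ} (hb : b ≤ n) :
    IsProbabilityMeasure (uniformOn (Set.univ : Set (Batch n b))) := by
  have hcard : 0 < Fintype.card (Batch n b) := (card_batch n b).symm ▸ Nat.choose_pos hb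
  have : Nonempty (Batch n b) := Fintype.card_pos_iff.1 hcard
  exact isProbabilityMeasure_uniformOn Set.finite_univ Set.univ_nonempty

instance (p : ℝ) : IsFiniteMeasure (coinLaw p) := by
  have := Measure.smul_finite (Measure.dirac true) (c := ENNReal.ofReal p) ENNReal.ofReal_ne_top
  have := Measure.smul_finite (Measure.dirac false) (c := ENNReal.ofReal (1 - p))
    ENNReal.ofReal_ne_top
  unfold coinLaw
  infer_instance

theorem integral_coinLaw {p : ℝ} (hp₀ : 0 ≤ p) (hp₁ : p ≤ 1) (h : Bool → ℝ) :
    ∫ a, h a ∂(coinLaw p) = p * h true + (1 - p) * h false := by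
  have := Measure.smul_finite (Measure.dirac true) (c := ENNReal.ofReal p) ENNReal.ofReal_ne_top
  have := Measure.smul_finite (Measure.dirac false) (c := ENNReal.ofReal (1 - p))
    ENNReal.ofReal_ne_top
  unfold coinLaw
  rw [integral_add_measure Integrable.of_finite Integrable.of_finite, integral_smul_measure,
    integral_smul_measure, integral_dirac, integral_dirac, ENNReal.toReal_ofReal hp₀,
    ENNReal.toReal_ofReal (sub_nonneg.2 hp₁), smul_eq_mul, smul_eq_mul]

theorem integral_sampleLaw {n B b : ℕ} (hB : B ≤ n) {p : ℝ} (hp₀ : 0 ≤ p)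
    (hp₁ : p ≤ 1) (h : Bool → Batch n b → ℝ) :
    ∫ s, h s.1 s.2.2 ∂(sampleLaw n B b p) =
      p * ((n.choose b : ℝ)⁻¹ * ∑ S, h true S) +
        (1 - p) * ((n.choose b : ℝ)⁻¹ * ∑ S, h false S) := by
  have := isProbabilityMeasure_uniformOn_batch hB
  have hbatches : ∀ c, ∫ y : Batch n B × Batch n b, h c y.2 ∂((uniformOn Set.univ).prod
      (uniformOn Set.univ)) = (n.choose b : ℝ)⁻¹ * ∑ S, h c S := fun c ↦ by
    rw [integral_fun_snd (h c), integral_uniformOn_univ, card_batch, probReal_univ, one_smul,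
      smul_eq_mul]
  unfold sampleLaw
  rw [integral_prod _ Integrable.of_finite, integral_coinLaw hp₀ hp₁, hbatches, hbatches]

end Laws

theorem mul_add_sq_le_one_of_stepsize_le {L p η : ℝ} {b : ℕ} (hL : 0 < L) (hp₀ : 0 ≤ p)
    (hp₁ : p ≤ 1) (hη₀ : 0 ≤ η) (hη : η ≤ 1 / (L * (1 + √((1 - p) / (p * b))))) :
    L * η + (1 - p) / (p * b) * (L * η) ^ 2 ≤ 1 := by
  set r := √((1 - p) / (p * b))
  have hr : 0 ≤ r := Real.sqrt_nonneg _
  have hsq : (1 - p) / (p * b) = r ^ 2 :=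
    (Real.sq_sqrt (div_nonneg (sub_nonneg.2 hp₁) (by positivity))).symm
  have hLη : 0 ≤ L * η := by positivity
  rw [le_div_iff₀ (by positivity)] at hη
  calc L * η + (1 - p) / (p * b) * (L * η) ^ 2
    _ = L * η + L * η * r * (L * η * r) := by rw [hsq]; ring
    _ ≤ L * η + L * η * r * 1 := by
      gcongr
      linarith only [hη, hLη]
    _ ≤ 1 := by linarith only [hη]

section Step

variable {E : Type*} [NormedAddCommGroup E] [NormedSpace ℝ E] [FiniteDimensional ℝ E]
  {M : Type*} [TopologicalSpace M] [ChartedSpace E M]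
  [RiemannianBundle (fun x : M ↦ TangentSpace 𝓘(ℝ, E) x)]
  {n b : ℕ} {f : Fin n → M → ℝ} {fstar η p L : ℝ}

theorem riemGrad_objective (hf : ∀ i, MDifferentiable 𝓘(ℝ, E) 𝓘(ℝ, ℝ) (f i)) (x : M) :
    riemGrad E (objective f) x = (n : ℝ)⁻¹ • ∑ i, riemGrad E (f i) x := by
  refine ext_inner_right ℝ fun w ↦ ?_
  have hsum := (HasMFDerivAt.sum (t := Finset.univ)
    (fun i _ ↦ (hf i x).hasMFDerivAt)).const_smul (n : ℝ)⁻¹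
  have hobjective : objective f = (n : ℝ)⁻¹ • ∑ i, f i := by
    ext x
    rw [objective, Pi.smul_apply, Finset.sum_apply, smul_eq_mul]
  have hevaluate : ∀ (r : ℝ) (l : Fin n → E →L[ℝ] ℝ) (w : E),
      (r • ∑ i, l i) w = r * ∑ i, l i w := fun r l w ↦ by
    rw [_root_.smul_apply, _root_.sum_apply, smul_eq_mul]
  rw [inner_riemGrad, real_inner_smul_left, sum_inner, hobjective,
    DFunLike.congr_fun hsum.mfderiv w]
  simp_rw [inner_riemGrad]
  exact hevaluate _ (fun i ↦ mfderiv 𝓘(ℝ, E) 𝓘(ℝ, ℝ) (f i) x) w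

theorem batchGrad_full (hf : ∀ i, MDifferentiable 𝓘(ℝ, E) 𝓘(ℝ, ℝ) (f i)) (S : Batch n n) (x : M) :
    batchGrad E f S x = riemGrad E (objective f) x := by
  have huniv : S.1 = Finset.univ :=
    (Finset.card_eq_iff_eq_univ _).1 (S.2.trans (Fintype.card_fin n).symm)
  rw [riemGrad_objective hf, batchGrad, huniv]

/-- The recursive estimate of the gradient at `Exp_x(v)` that R-PAGE computes from the estimate
`g` at `x` and the minibatch `S` when its coin does not ask for a large minibatch. -/
noncomputable def recursiveGrad (f : Fin n → M → ℝ) (x : M) (v g : TangentSpace 𝓘(ℝ, E) x)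
    (S : Batch n b) : TangentSpace 𝓘(ℝ, E) (riemExp x v) :=
  expTransport x v g + batchGrad E f S (riemExp x v) - expTransport x v (batchGrad E f S x)

/-- The Lyapunov function of R-PAGE: the suboptimality of the iterate plus a multiple of the
squared error of its gradient estimate. -/
noncomputable def potential (f : Fin n → M → ℝ) (fstar η p : ℝ) (z : TangentBundle 𝓘(ℝ, E) M) :
    ℝ :=
  objective f z.1 - fstar + η / (2 * p) * ‖z.2 - riemGrad E (objective f) z.1‖ ^ 2

theorem potential_nonneg (hfstar : ∀ x, fstar ≤ objective f x) (hη : 0 ≤ η) (hp : 0 ≤ p)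
    (z : TangentBundle 𝓘(ℝ, E) M) : 0 ≤ potential f fstar η p z := by
  have hgap : 0 ≤ objective f z.1 - fstar := sub_nonneg.2 (hfstar z.1)
  unfold potential
  positivity

theorem potential_batchGrad_full (hf : ∀ i, MDifferentiable 𝓘(ℝ, E) 𝓘(ℝ, ℝ) (f i)) (S : Batch n n)
    (x : M) : potential f fstar η p ⟨x, batchGrad E f S x⟩ = objective f x - fstar := by
  have herror : ‖batchGrad E f S x - riemGrad E (objective f) x‖ = 0 := by
    rw [batchGrad_full hf, sub_self, norm_zero]
  rw [potential]
  dsimp only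
  rw [herror, zero_pow two_ne_zero, mul_zero, add_zero]

theorem potential_rpageStep (hf : ∀ i, MDifferentiable 𝓘(ℝ, E) 𝓘(ℝ, ℝ) (f i)) (x : M)
    (g : TangentSpace 𝓘(ℝ, E) x) (s : Sample n n b) :
    potential f fstar η p (rpageStep f η ⟨x, g⟩ s) =
      objective f (riemExp x (-(η • g))) - fstar + η / (2 * p) * if s.1 = true then 0 else
        ‖recursiveGrad f x (-(η • g)) g s.2.2
          - riemGrad E (objective f) (riemExp x (-(η • g)))‖ ^ 2 := by
  obtain ⟨coin, S, S'⟩ := s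
  cases coin
  · rfl
  · refine (potential_batchGrad_full hf S _).trans ?_
    rw [if_pos rfl, mul_zero, add_zero]

theorem integral_potential_rpageStep (hf : ∀ i, MDifferentiable 𝓘(ℝ, E) 𝓘(ℝ, ℝ) (f i))
    (hp₀ : 0 ≤ p) (hp₁ : p ≤ 1) (hb : b ≤ n) (x : M) (g : TangentSpace 𝓘(ℝ, E) x) :
    ∫ s, potential f fstar η p (rpageStep f η ⟨x, g⟩ s) ∂(sampleLaw n n b p) =
      objective f (riemExp x (-(η • g))) - fstar + η / (2 * p) * ((1 - p) *
        ((n.choose b : ℝ)⁻¹ * ∑ S : Batch n b, ‖recursiveGrad f x (-(η • g)) g S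
          - riemGrad E (objective f) (riemExp x (-(η • g)))‖ ^ 2)) := by
  have hchoose : (n.choose b : ℝ) ≠ 0 := Nat.cast_ne_zero.2 (Nat.choose_pos hb).ne'
  have hcard : (Finset.univ : Finset (Batch n b)).card = n.choose b := card_batch n b
  simp only [potential_rpageStep hf]
  rw [integral_sampleLaw le_rfl hp₀ hp₁ fun coin S ↦ objective f (riemExp x (-(η • g))) - fstar +
    η / (2 * p) * if coin = true then 0 else ‖recursiveGrad f x (-(η • g)) g S
      - riemGrad E (objective f) (riemExp x (-(η • g)))‖ ^ 2]
  simp only [if_true, Bool.false_eq_true, if_false, Finset.sum_add_distrib, Finset.sum_const,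
    hcard, nsmul_eq_mul, ← Finset.mul_sum, mul_zero, add_zero, mul_add,
    inv_mul_cancel_left₀ hchoose]
  ring

variable [IsManifold 𝓘(ℝ, E) 2 M]
  [IsContMDiffRiemannianBundle 𝓘(ℝ, E) 1 E (fun x : M ↦ TangentSpace 𝓘(ℝ, E) x)]

theorem objective_riemExp_le (hM : GeodesicallyComplete E M) (hf : ∀ i, GSmooth E L (f i))
    (hn : 0 < n) (x : M) (v : TangentSpace 𝓘(ℝ, E) x) :
    objective f (riemExp x v) ≤
      objective f x + inner ℝ (riemGrad E (objective f) x) v + L / 2 * ‖v‖ ^ 2 := by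
  have hn' : (n : ℝ) ≠ 0 := Nat.cast_ne_zero.2 hn.ne'
  calc (n : ℝ)⁻¹ * ∑ i, f i (riemExp x v)
    _ ≤ (n : ℝ)⁻¹ * ∑ i, (f i x + inner ℝ (riemGrad E (f i) x) v + L / 2 * ‖v‖ ^ 2) := by
      gcongr with i
      exact hM.riemExp_le (hf i) x v
    _ = objective f x + inner ℝ (riemGrad E (objective f) x) v + L / 2 * ‖v‖ ^ 2 := by
      rw [riemGrad_objective (fun i ↦ (hf i).1), real_inner_smul_left, sum_inner,
        Finset.sum_add_distrib, Finset.sum_add_distrib, Finset.sum_const, Finset.card_univ,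
        Fintype.card_fin, nsmul_eq_mul, mul_add, mul_add, inv_mul_cancel_left₀ hn', objective]

theorem objective_riemExp_neg_smul_le (hM : GeodesicallyComplete E M)
    (hf : ∀ i, GSmooth E L (f i)) (hn : 0 < n) (η : ℝ) (x : M) (g : TangentSpace 𝓘(ℝ, E) x) :
    objective f (riemExp x (-(η • g))) ≤ objective f x
      - η / 2 * ‖riemGrad E (objective f) x‖ ^ 2 - η / 2 * (1 - L * η) * ‖g‖ ^ 2
      + η / 2 * ‖g - riemGrad E (objective f) x‖ ^ 2 := by
  have hdescent := objective_riemExp_le hM hf hn x (-(η • g))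
  have hnorm : ‖-(η • g)‖ ^ 2 = η ^ 2 * ‖g‖ ^ 2 := by
    rw [norm_neg, norm_smul, mul_pow, Real.norm_eq_abs, sq_abs]
  have hpolarization := norm_sub_sq_real g (riemGrad E (objective f) x)
  rw [hnorm, inner_neg_right, real_inner_smul_right, real_inner_comm] at hdescent
  rw [hpolarization]
  linarith only [hdescent]

theorem mean_recursiveGrad_error_sq_le (hM : GeodesicallyComplete E M)
    (hf : ∀ i, GSmooth E L (f i)) (hb₀ : 0 < b) (hb : b ≤ n) (x : M)
    (v g : TangentSpace 𝓘(ℝ, E) x) :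
    (n.choose b : ℝ)⁻¹ * ∑ S : Batch n b,
        ‖recursiveGrad f x v g S - riemGrad E (objective f) (riemExp x v)‖ ^ 2
      ≤ ‖g - riemGrad E (objective f) x‖ ^ 2 + (L * ‖v‖) ^ 2 / b := by
  have hfd := fun i ↦ (hf i).1
  have hn : (n : ℝ) ≠ 0 := Nat.cast_ne_zero.2 (hb₀.trans_le hb).ne'
  obtain ⟨T, hT⟩ := hM.exists_linearIsometry_eq_expTransport x v
  set F := riemGrad E (objective f) x with hF
  set a : Fin n → TangentSpace 𝓘(ℝ, E) (riemExp x v) := fun i ↦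
    riemGrad E (f i) (riemExp x v) - T (riemGrad E (f i) x) with ha
  have hbound : ∀ i, ‖a i‖ ≤ L * ‖v‖ := fun i ↦ by
    simp only [ha, ← hT]
    exact hM.norm_riemGrad_riemExp_sub_expTransport_le (hf i) x v
  have herror : ∀ S : Batch n b, recursiveGrad f x v g S - riemGrad E (objective f) (riemExp x v)
      = T (g - F) + ((b : ℝ)⁻¹ • ∑ i ∈ S.1, a i - (n : ℝ)⁻¹ • ∑ i, a i) := fun S ↦ by
    simp only [recursiveGrad, hT, batchGrad, hF, riemGrad_objective hfd, ha, map_sub, map_smul,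
      map_sum, Finset.sum_sub_distrib, smul_sub]
    abel
  have hsampling := mean_norm_sq_add_batchMean_sub_mean_le (t := Finset.univ) hb₀
    (hb.trans_eq (Finset.card_fin n).symm) (T (g - F)) a
  rw [Finset.card_fin, T.norm_map] at hsampling
  simp only [herror]
  rw [sum_batch n b fun S ↦ ‖T (g - F) + ((b : ℝ)⁻¹ • ∑ i ∈ S, a i - (n : ℝ)⁻¹ • ∑ i, a i)‖ ^ 2]
  calc _ ≤ _ := hsampling
    _ ≤ ‖g - F‖ ^ 2 + (b : ℝ)⁻¹ * ((n : ℝ)⁻¹ * ∑ _i : Fin n, (L * ‖v‖) ^ 2) := by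
      gcongr with i
      exact hbound i
    _ = ‖g - F‖ ^ 2 + (L * ‖v‖) ^ 2 / b := by
      rw [Finset.sum_const, Finset.card_fin, nsmul_eq_mul, inv_mul_cancel_left₀ hn, inv_mul_eq_div]

theorem integral_potential_rpageStep_le (hM : GeodesicallyComplete E M) (hL : 0 < L)
    (hf : ∀ i, GSmooth E L (f i)) (hp₀ : 0 < p) (hp₁ : p ≤ 1) (hb₀ : 0 < b) (hb : b ≤ n)
    (hη₀ : 0 ≤ η) (hη : η ≤ 1 / (L * (1 + √((1 - p) / (p * b)))))
    (z : TangentBundle 𝓘(ℝ, E) M) :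
    ∫ s, potential f fstar η p (rpageStep f η z s) ∂(sampleLaw n n b p) ≤
      potential f fstar η p z - η / 2 * ‖riemGrad E (objective f) z.1‖ ^ 2 := by
  obtain ⟨x, g⟩ := z
  have hdescent := objective_riemExp_neg_smul_le hM hf (hb₀.trans_le hb) η x g
  have herror := mean_recursiveGrad_error_sq_le hM hf hb₀ hb x (-(η • g)) g
  rw [norm_neg, norm_smul, Real.norm_of_nonneg hη₀] at herror
  have hstepsize := mul_le_mul_of_nonneg_left
    (mul_add_sq_le_one_of_stepsize_le hL hp₀.le hp₁ hη₀ hη) (show 0 ≤ η / 2 * ‖g‖ ^ 2 by positivity)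
  rw [integral_potential_rpageStep (fun i ↦ (hf i).1) hp₀.le hp₁ hb, potential]
  dsimp only
  set F := riemGrad E (objective f) x
  set meanError := (n.choose b : ℝ)⁻¹ * ∑ S : Batch n b, ‖recursiveGrad f x (-(η • g)) g S
    - riemGrad E (objective f) (riemExp x (-(η • g)))‖ ^ 2
  have hweighted : η / (2 * p) * ((1 - p) * meanError) ≤ η / (2 * p) * ‖g - F‖ ^ 2
      - η / 2 * ‖g - F‖ ^ 2 + η / 2 * ‖g‖ ^ 2 * ((1 - p) / (p * b) * (L * η) ^ 2) := by
    calc η / (2 * p) * ((1 - p) * meanError)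
      _ ≤ η / (2 * p) * ((1 - p) * (‖g - F‖ ^ 2 + (L * (η * ‖g‖)) ^ 2 / b)) := by
        have : 0 ≤ 1 - p := sub_nonneg.2 hp₁
        gcongr
      _ = _ := by field_simp
  linarith only [hdescent, hweighted, hstepsize]

end Step

section Independence

variable {Ω α β ι : Type*} [MeasurableSpace Ω] {P : Measure Ω} [IsFiniteMeasure P]
  [MeasurableSpace α] [Finite α] [MeasurableSingletonClass α]
  [MeasurableSpace β] [Finite β] [MeasurableSingletonClass β]

theorem integrable_comp_of_finite {X : Ω → α} (hX : Measurable X) (h : α → ℝ) :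
    Integrable (fun o ↦ h (X o)) P :=
  (Integrable.of_finite (f := h)).comp_measurable hX

theorem integral_comp_of_indepFun {X : Ω → α} {Y : Ω → β} (hX : Measurable X) (hY : Measurable Y)
    (hXY : IndepFun X Y P) (h : α → β → ℝ) :
    ∫ o, h (X o) (Y o) ∂P = ∫ o, ∫ b, h (X o) b ∂(P.map Y) ∂P := by
  calc ∫ o, h (X o) (Y o) ∂P
    _ = ∫ q, h q.1 q.2 ∂(P.map fun o ↦ (X o, Y o)) :=
      (integral_map (hX.prodMk hY).aemeasurable
        (Integrable.of_finite (f := fun q : α × β ↦ h q.1 q.2)).aestronglyMeasurable).symm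
    _ = ∫ a, ∫ b, h a b ∂(P.map Y) ∂(P.map X) := by
      rw [(indepFun_iff_map_prod_eq_prod_map_map hX.aemeasurable hY.aemeasurable).1 hXY,
        integral_prod _ Integrable.of_finite]
    _ = ∫ o, ∫ b, h (X o) b ∂(P.map Y) ∂P :=
      integral_map hX.aemeasurable
        (Integrable.of_finite (f := fun a ↦ ∫ b, h a b ∂(P.map Y))).aestronglyMeasurable

theorem integrable_of_dependsOn {ξ : ι → Ω → α} (hξ : ∀ i, Measurable (ξ i)) {t : Finset ι}
    {F : (ι → α) → ℝ} (hF : DependsOn F t) : Integrable (fun o ↦ F fun i ↦ ξ i o) P := by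
  obtain ⟨G, rfl⟩ := dependsOn_iff_exists_comp.1 hF
  exact integrable_comp_of_finite (X := fun o (i : t) ↦ ξ i o)
    (measurable_pi_lambda _ fun i ↦ hξ i) G

theorem integrable_of_dependsOn_prod {ξ : ι → Ω → α} {Y : Ω → β} (hξ : ∀ i, Measurable (ξ i))
    (hY : Measurable Y) {t : Finset ι} {F : (ι → α) → β → ℝ} (hF : DependsOn F t) :
    Integrable (fun o ↦ F (fun i ↦ ξ i o) (Y o)) P := by
  obtain ⟨G, rfl⟩ := dependsOn_iff_exists_comp.1 hF
  exact integrable_comp_of_finite (X := fun o ↦ ((fun i : t ↦ ξ i o), Y o))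
    (Measurable.prodMk (measurable_pi_lambda _ fun i : t ↦ hξ i) hY) fun q ↦ G q.1 q.2

theorem integral_of_dependsOn_of_indepFun {ξ : ι → Ω → α} {Y : Ω → β}
    (hξ : ∀ i, Measurable (ξ i)) (hY : Measurable Y) {t : Finset ι}
    (hξY : IndepFun (fun o (i : t) ↦ ξ i o) Y P) {F : (ι → α) → β → ℝ} (hF : DependsOn F t) :
    ∫ o, F (fun i ↦ ξ i o) (Y o) ∂P = ∫ o, ∫ b, F (fun i ↦ ξ i o) b ∂(P.map Y) ∂P := by
  obtain ⟨G, rfl⟩ := dependsOn_iff_exists_comp.1 hF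
  exact integral_comp_of_indepFun (measurable_pi_lambda _ fun i : t ↦ hξ i) hY hξY G

end Independence

section Convergence

variable {E : Type*} [NormedAddCommGroup E] [NormedSpace ℝ E] [FiniteDimensional ℝ E]
  {M : Type*} [TopologicalSpace M] [ChartedSpace E M]
  [RiemannianBundle (fun x : M ↦ TangentSpace 𝓘(ℝ, E) x)]
  {n B b K : ℕ} {f : Fin n → M → ℝ} {fstar L η p : ℝ} {x₀ : M}

theorem dependsOn_rpage (f : Fin n → M → ℝ) (η : ℝ) (x₀ : M) {k m : ℕ} (hk : k < m) :
    DependsOn (fun s : ℕ → Sample n B b ↦ rpage E f η x₀ s k) (Finset.range m : Set ℕ) := by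
  intro s s' hs
  have hagree : ∀ j ≤ k, s j = s' j := fun j hj ↦
    hs j (Finset.mem_coe.2 (Finset.mem_range.2 (hj.trans_lt hk)))
  clear hs hk
  induction k with
  | zero => simp only [rpage, hagree 0 le_rfl]
  | succ k ih =>
    have hrec : rpage E f η x₀ s k = rpage E f η x₀ s' k :=
      ih fun j hj ↦ hagree j (hj.trans k.le_succ)
    simp only [rpage, hrec, hagree (k + 1) le_rfl]

variable {Ω : Type*} [MeasurableSpace Ω] {P : Measure Ω} [IsProbabilityMeasure P]
  {ξ : ℕ → Ω → Sample n B b} {J : Ω → Fin K}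

theorem IsSampling.integrable_rpage (h : IsSampling P p ξ J) (f : Fin n → M → ℝ) (η : ℝ) (x₀ : M)
    (k : ℕ) (q : TangentBundle 𝓘(ℝ, E) M → ℝ) :
    Integrable (fun o ↦ q (rpage E f η x₀ (fun j ↦ ξ j o) k)) P :=
  integrable_of_dependsOn (F := fun s ↦ q (rpage E f η x₀ s k)) h.measurable_sample
    fun _ _ hs ↦ congrArg q (dependsOn_rpage f η x₀ k.lt_succ_self hs)

theorem IsSampling.integral_rpage_succ (h : IsSampling P p ξ J) (f : Fin n → M → ℝ) (η : ℝ)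
    (x₀ : M) (k : ℕ) (q : TangentBundle 𝓘(ℝ, E) M → ℝ) :
    ∫ o, q (rpage E f η x₀ (fun j ↦ ξ j o) (k + 1)) ∂P =
      ∫ o, ∫ s, q (rpageStep f η (rpage E f η x₀ (fun j ↦ ξ j o) k) s) ∂(sampleLaw n B b p) ∂P := by
  have hblocks := h.indep_samples.indepFun_finset (Finset.range (k + 1)) {k + 1}
    (Finset.disjoint_singleton_right.2 Finset.notMem_range_self) h.measurable_sample
  have hindep : IndepFun (fun o (i : Finset.range (k + 1)) ↦ ξ i o) (ξ (k + 1)) P :=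
    hblocks.comp measurable_id
      (measurable_pi_apply (⟨k + 1, Finset.mem_singleton_self _⟩ : ({k + 1} : Finset ℕ)))
  rw [← h.law_sample (k + 1)]
  exact integral_of_dependsOn_of_indepFun
    (F := fun s y ↦ q (rpageStep f η (rpage E f η x₀ s k) y))
    h.measurable_sample (h.measurable_sample (k + 1)) hindep fun _ _ hs ↦ funext fun y ↦
      congrArg (fun z ↦ q (rpageStep f η z y)) (dependsOn_rpage f η x₀ k.lt_succ_self hs)

theorem IsSampling.integrable_rpage_index (h : IsSampling P p ξ J) (f : Fin n → M → ℝ) (η : ℝ)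
    (x₀ : M) (q : TangentBundle 𝓘(ℝ, E) M → ℝ) :
    Integrable (fun o ↦ q (rpage E f η x₀ (fun j ↦ ξ j o) (J o))) P :=
  integrable_of_dependsOn_prod (F := fun s (j : Fin K) ↦ q (rpage E f η x₀ s j))
    h.measurable_sample h.measurable_index fun _ _ hs ↦ funext fun j ↦
      congrArg q (dependsOn_rpage f η x₀ j.2 hs)

theorem IsSampling.integral_rpage_index (h : IsSampling P p ξ J) (f : Fin n → M → ℝ) (η : ℝ)
    (x₀ : M) (q : TangentBundle 𝓘(ℝ, E) M → ℝ) :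
    ∫ o, q (rpage E f η x₀ (fun j ↦ ξ j o) (J o)) ∂P =
      (K : ℝ)⁻¹ * ∑ k ∈ Finset.range K, ∫ o, q (rpage E f η x₀ (fun j ↦ ξ j o) k) ∂P := by
  have hrestrict : Measurable fun (s : ℕ → Sample n B b) (i : Finset.range K) ↦ s i :=
    measurable_pi_lambda _ fun i ↦ measurable_pi_apply _
  have hindep : IndepFun (fun o (i : Finset.range K) ↦ ξ i o) J P :=
    (h.indep_index.comp measurable_id hrestrict).symm
  rw [integral_of_dependsOn_of_indepFun (F := fun s (j : Fin K) ↦ q (rpage E f η x₀ s j))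
    h.measurable_sample h.measurable_index hindep fun _ _ hs ↦ funext fun j ↦
      congrArg q (dependsOn_rpage f η x₀ j.2 hs), h.law_index]
  simp only [integral_uniformOn_univ, Fintype.card_fin, smul_eq_mul]
  rw [integral_const_mul, integral_finsetSum _ fun (j : Fin K) _ ↦ h.integrable_rpage f η x₀ j q,
    ← Fin.sum_univ_eq_sum_range fun k ↦ ∫ o, q (rpage E f η x₀ (fun j ↦ ξ j o) k) ∂P]

end Convergence

theorem mul_sum_range_le_of_succ_le_sub {Φ G : ℕ → ℝ} {c : ℝ} (hΦ : ∀ k, 0 ≤ Φ k)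
    (hstep : ∀ k, Φ (k + 1) ≤ Φ k - c * G k) (K : ℕ) :
    c * ∑ k ∈ Finset.range K, G k ≤ Φ 0 := by
  calc c * ∑ k ∈ Finset.range K, G k
    _ = ∑ k ∈ Finset.range K, c * G k := Finset.mul_sum ..
    _ ≤ ∑ k ∈ Finset.range K, (Φ k - Φ (k + 1)) :=
      Finset.sum_le_sum fun k _ ↦ le_sub_comm.1 (hstep k)
    _ = Φ 0 - Φ K := Finset.sum_range_sub' Φ K
    _ ≤ Φ 0 := sub_le_self _ (hΦ K)

section Rate

variable {E : Type*} [NormedAddCommGroup E] [NormedSpace ℝ E] [FiniteDimensional ℝ E]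
  {M : Type*} [TopologicalSpace M] [ChartedSpace E M]
  [RiemannianBundle (fun x : M ↦ TangentSpace 𝓘(ℝ, E) x)]
  {n b K : ℕ} {f : Fin n → M → ℝ} {fstar L η p : ℝ}

variable [IsManifold 𝓘(ℝ, E) 2 M]
  [IsContMDiffRiemannianBundle 𝓘(ℝ, E) 1 E (fun x : M ↦ TangentSpace 𝓘(ℝ, E) x)]
  {Ω : Type*} [MeasurableSpace Ω] {P : Measure Ω} [IsProbabilityMeasure P]
  {ξ : ℕ → Ω → Sample n n b} {J : Ω → Fin K}

theorem IsSampling.integral_potential_succ_le (hsamp : IsSampling P p ξ J)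
    (hM : GeodesicallyComplete E M) (hL : 0 < L) (hf : ∀ i, GSmooth E L (f i)) (hp₀ : 0 < p)
    (hp₁ : p ≤ 1) (hb₀ : 0 < b) (hb : b ≤ n) (hη₀ : 0 ≤ η)
    (hη : η ≤ 1 / (L * (1 + √((1 - p) / (p * b))))) (x₀ : M) (k : ℕ) :
    ∫ o, potential f fstar η p (rpage E f η x₀ (fun j ↦ ξ j o) (k + 1)) ∂P ≤
      ∫ o, potential f fstar η p (rpage E f η x₀ (fun j ↦ ξ j o) k) ∂P - η / 2 *
        ∫ o, ‖riemGrad E (objective f) (rpage E f η x₀ (fun j ↦ ξ j o) k).1‖ ^ 2 ∂P := by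
  have hpotential := hsamp.integrable_rpage (E := E) f η x₀ k (potential f fstar η p)
  have hgrad := (hsamp.integrable_rpage (E := E) f η x₀ k
    fun z ↦ ‖riemGrad E (objective f) z.1‖ ^ 2).const_mul (η / 2)
  rw [hsamp.integral_rpage_succ f η x₀ k, ← integral_const_mul, ← integral_sub hpotential hgrad]
  refine integral_mono (hsamp.integrable_rpage f η x₀ k fun z ↦
    ∫ s, potential f fstar η p (rpageStep f η z s) ∂(sampleLaw n n b p))
    (hpotential.sub hgrad) fun o ↦ ?_
  exact integral_potential_rpageStep_le hM hL hf hp₀ hp₁ hb₀ hb hη₀ hη _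

end Rate

end RPage

theorem theorem2_general
    {E : Type*} [NormedAddCommGroup E] [NormedSpace ℝ E] [FiniteDimensional ℝ E]
    {M : Type*} [TopologicalSpace M] [ChartedSpace E M] [IsManifold 𝓘(ℝ, E) 2 M]
    [RiemannianBundle (fun x : M ↦ TangentSpace 𝓘(ℝ, E) x)]
    [IsContMDiffRiemannianBundle 𝓘(ℝ, E) 1 E (fun x : M ↦ TangentSpace 𝓘(ℝ, E) x)]
    (hM : GeodesicallyComplete E M)
    {n : ℕ} (f : Fin n → M → ℝ) (L : ℝ) (hL : 0 < L) (hf : ∀ i, GSmooth E L (f i))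
    (fstar : ℝ) (hfstar : ∀ x, fstar ≤ objective f x)
    (x₀ : M) (p : ℝ) (hp₀ : 0 < p) (hp₁ : p ≤ 1) (b : ℕ) (hb₀ : 0 < b) (hb : b ≤ n)
    (η : ℝ) (hη₀ : 0 < η) (hη : η ≤ 1 / (L * (1 + √((1 - p) / (p * b)))))
    {K : ℕ} {Ω : Type*} [MeasurableSpace Ω] (P : Measure Ω) [IsProbabilityMeasure P]
    (ξ : ℕ → Ω → Sample n n b) (J : Ω → Fin K) (hsamp : IsSampling P p ξ J) :
    Integrable
        (fun o ↦ ‖riemGrad E (objective f) (rpage E f η x₀ (fun k ↦ ξ k o) (J o)).1‖ ^ 2) P ∧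
      ∫ o, ‖riemGrad E (objective f) (rpage E f η x₀ (fun k ↦ ξ k o) (J o)).1‖ ^ 2 ∂P
        ≤ 2 * (objective f x₀ - fstar) / (η * K) := by
  set gradNormSq : TangentBundle 𝓘(ℝ, E) M → ℝ := fun z ↦ ‖riemGrad E (objective f) z.1‖ ^ 2
  have htelescope := mul_sum_range_le_of_succ_le_sub
    (Φ := fun k ↦ ∫ o, potential f fstar η p (rpage E f η x₀ (fun j ↦ ξ j o) k) ∂P)
    (fun k ↦ integral_nonneg fun o ↦ potential_nonneg hfstar hη₀.le hp₀.le _)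
    (hsamp.integral_potential_succ_le hM hL hf hp₀ hp₁ hb₀ hb hη₀.le hη x₀) K
  simp only [rpage, potential_batchGrad_full fun i ↦ (hf i).1, integral_const, probReal_univ,
    one_smul] at htelescope
  refine ⟨hsamp.integrable_rpage_index f η x₀ gradNormSq, ?_⟩
  calc ∫ o, gradNormSq (rpage E f η x₀ (fun k ↦ ξ k o) (J o)) ∂P
    _ = (K : ℝ)⁻¹ * ∑ k ∈ Finset.range K,
        ∫ o, gradNormSq (rpage E f η x₀ (fun j ↦ ξ j o) k) ∂P :=
      hsamp.integral_rpage_index f η x₀ gradNormSq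
    _ ≤ (K : ℝ)⁻¹ * ((objective f x₀ - fstar) / (η / 2)) := by
      gcongr
      exact (le_div_iff₀' (half_pos hη₀)).2 htelescope
    _ = 2 * (objective f x₀ - fstar) / (η * K) := by ring

theorem theorem2
    {E : Type*} [NormedAddCommGroup E] [NormedSpace ℝ E] [FiniteDimensional ℝ E]
    {M : Type*} [TopologicalSpace M] [T2Space M] [ChartedSpace E M] [IsManifold 𝓘(ℝ, E) ∞ M]
    [RiemannianBundle (fun x : M ↦ TangentSpace 𝓘(ℝ, E) x)]
    [IsContMDiffRiemannianBundle 𝓘(ℝ, E) ∞ E (fun x : M ↦ TangentSpace 𝓘(ℝ, E) x)]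
    (hM : GeodesicallyComplete E M)
    {n : ℕ} (f : Fin n → M → ℝ) (L : ℝ) (hL : 0 < L) (hf : ∀ i, GSmooth E L (f i))
    (fstar : ℝ) (hfstar : ∀ x, fstar ≤ objective f x)
    (x₀ : M) (p : ℝ) (hp₀ : 0 < p) (hp₁ : p ≤ 1)
    (B b : ℕ) (hB : B = n) (hb₀ : 0 < b) (hb : b < B)
    (η : ℝ) (hη₀ : 0 < η) (hη : η ≤ 1 / (L * (1 + √((1 - p) / (p * b)))))
    (K : ℕ) (hK : 0 < K)
    {Ω : Type*} [MeasurableSpace Ω] (P : Measure Ω) [IsProbabilityMeasure P]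
    (ξ : ℕ → Ω → Sample n B b) (J : Ω → Fin K) (hsamp : IsSampling P p ξ J) :
    Integrable
        (fun o ↦ ‖riemGrad E (objective f) (rpage E f η x₀ (fun k ↦ ξ k o) (J o)).1‖ ^ 2) P ∧
      ∫ o, ‖riemGrad E (objective f) (rpage E f η x₀ (fun k ↦ ξ k o) (J o)).1‖ ^ 2 ∂P
        ≤ 2 * (objective f x₀ - fstar) / (η * K) := by
  subst hB
  have : IsManifold 𝓘(ℝ, E) 2 M := .of_le (n := ∞) (by norm_cast)
  have : IsContMDiffRiemannianBundle 𝓘(ℝ, E) 1 E (fun x : M ↦ TangentSpace 𝓘(ℝ, E) x) :=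
    .of_le (n := ∞) (by norm_cast)
  exact theorem2_general hM f L hL hf fstar hfstar x₀ p hp₀ hp₁ b hb₀ hb.le η hη₀ hη P ξ J hsamp
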